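/- Let $c=\rho_*>0$ be a constant and let $s\ge 3$ be an integer. Consider on $\mathbb R^3$ the linear Cauchy problem $$\partial_t\phi+\operatorname{div}u=0,\qquad \partial_t u+\nabla\phi+u-v=0,\qquad \partial_t v+cv-c\mathcal J u-\Delta v=0,\qquad (\phi,u,v)|_{t=0}=(\phi_0,u_0,v_0),$$ for a scalar field $\phi$ and vector fields $u,v$ that vanish as $|x|\to\infty$, where $\mathcal J=\mathrm I+\nabla(-\Delta)^{-1}\operatorname{div}$ is the Fourier multiplier with symbol $\mathrm I-\frac{\xi\xi^t}{|\xi|^2}$. Let $\hat f(\xi)=(2\pi)^{-3/2}\int_{\mathbb R^3}f(x)e^{-ix\cdot\xi}\,dx$. Assume that the (real- or complex-valued) initial data satisfy $(\phi_0,u_0,v_0)\in H^s(\mathbb R^3)\cap L^1(\mathbb R^3)$, $\operatorname{div}v_0=0$, and that for some constants $c_0,r_0>0$ $$\inf_{|\xi|<r_0}|\hat\phi_0(\xi)|\ge c_0,\qquad \Big(\mathrm I-\frac{\xi\xi^t}{|\xi|^2}\Big)\hat u_0(\xi)=0\quad\text{for all }\xi\ne 0 .$$ Then the problem has a unique global solution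 $(\phi,u,v)\in C([0,\infty);H^s(\mathbb R^3))$ (the equations holding for every $t\ge 0$ in the sense of tempered distributions in $x$), and there are positive constants $c_*$, $C$, $t_0$, with $c_*$ and $C$ independent of $t$, such that for all $t\ge t_0$ $$c_*(1+t)^{-\frac34}\le \|(\phi,u,v)(t)\|_{L^2}\le C(1+t)^{-\frac34},$$ where $\|(\phi,u,v)\|_{L^2}=\|\phi\|_{L^2}+\|u\|_{L^2}+\|v\|_{L^2}$. -/

import Mathlib

open MeasureTheory FourierTransform
open scoped SchwartzMap LineDeriv Laplacian

noncomputable section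

namespace ENS

/-- Physical space (and frequency space) `ℝ³` with the Euclidean norm. -/
abbrev R3 : Type := EuclideanSpace ℝ (Fin 3)

/-- Scalar fields in `L²(ℝ³)`; complex values include the real-valued ones. -/
abbrev L2 : Type := Lp ℂ 2 (volume : Measure R3)

/-- Vector fields in `L²(ℝ³)³`; the norm is the `L²` norm, `‖u‖² = ∑ j, ‖u j‖²`. -/
abbrev L2Vec : Type := PiLp 2 (fun _ : Fin 3 => L2)

/-- The `j`-th coordinate vector. -/
def e (j : Fin 3) : R3 := EuclideanSpace.single j 1

/-- The Fourier transform `(2π)^{-3/2} ∫ f(x) e^{-i x·ξ} dx` of an integrable function. -/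
def ft (f : R3 → ℂ) (ξ : R3) : ℂ :=
  (((2 * Real.pi) ^ (-(3 / 2) : ℝ) : ℝ) : ℂ) *
    ∫ x, f x * Complex.exp (-(Complex.I * ((inner ℝ x ξ : ℝ) : ℂ)))

/-- The divergence of an `L²` vector field, as a tempered distribution. -/
def div (u : L2Vec) : 𝓢'(R3, ℂ) := ∑ j : Fin 3, ∂_{e j} (u j : 𝓢'(R3, ℂ))

/-- The symbol `(i ξ_j)(i ξ_k) / |ξ|²` of `∂_j (-Δ)⁻¹ ∂_k`. -/
def rieszSymbol (j k : Fin 3) (ξ : R3) : ℂ := ((-(ξ j * ξ k / ‖ξ‖ ^ 2) : ℝ) : ℂ)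

theorem norm_rieszSymbol_le (j k : Fin 3) (ξ : R3) : ‖rieszSymbol j k ξ‖ ≤ 1 := by
  have hj : |ξ j| ≤ ‖ξ‖ := by simpa using PiLp.norm_apply_le ξ j
  have hk : |ξ k| ≤ ‖ξ‖ := by simpa using PiLp.norm_apply_le ξ k
  rw [rieszSymbol, Complex.norm_real, Real.norm_eq_abs, abs_neg, abs_div, abs_mul,
    abs_of_nonneg (sq_nonneg ‖ξ‖)]
  refine div_le_one_of_le₀ ?_ (sq_nonneg _)
  rw [sq]
  exact mul_le_mul hj hk (abs_nonneg _) (norm_nonneg _)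

theorem measurable_rieszSymbol (j k : Fin 3) : Measurable (rieszSymbol j k) := by
  unfold rieszSymbol
  fun_prop

theorem memLp_rieszSymbol_mul (j k : Fin 3) (f : L2) :
    MemLp (fun ξ => rieszSymbol j k ξ * f ξ) 2 (volume : Measure R3) := by
  refine (Lp.memLp f).of_le
    ((measurable_rieszSymbol j k).aestronglyMeasurable.mul (Lp.aestronglyMeasurable f)) ?_
  filter_upwards with ξ
  rw [norm_mul]
  exact mul_le_of_le_one_left (norm_nonneg _) (norm_rieszSymbol_le j k ξ)

/-- The operator `∂_j (-Δ)⁻¹ ∂_k` on `L²(ℝ³)`, as a Fourier multiplier. Its symbol is homogeneous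
of degree zero, so the normalization of the Fourier transform is irrelevant. -/
def riesz (j k : Fin 3) (f : L2) : L2 := 𝓕⁻ ((memLp_rieszSymbol_mul j k (𝓕 f)).toLp _)

/-- The `j`-th component of `𝒥 u = u + ∇ (-Δ)⁻¹ div u`. -/
def projJ (u : L2Vec) (j : Fin 3) : L2 := u j + ∑ k : Fin 3, riesz j k (u k)

/-- `f ∈ H^s(ℝ³)`. -/
def MemH (s : ℕ) (f : L2) : Prop :=
  TemperedDistribution.MemSobolev (s : ℝ) 2 (f : 𝓢'(R3, ℂ))

/-- `f ∈ C([0,∞); H^s(ℝ³))`: the curve `⟨D⟩^s f(t)` is continuous in `L²` for `t ≥ 0`. -/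
def ContinuousInH (s : ℕ) (f : ℝ → L2) : Prop :=
  ∃ w : ℝ → L2, ContinuousOn w (Set.Ici 0) ∧
    ∀ t, 0 ≤ t → TemperedDistribution.besselPotential R3 ℂ (s : ℝ) (f t : 𝓢'(R3, ℂ)) =
      (w t : 𝓢'(R3, ℂ))

/-- `∂_t f = F` in the sense of tempered distributions in `x`, for every `t ≥ 0` (one-sided
derivative at `t = 0`). -/
def HasTimeDeriv (f : ℝ → L2) (F : ℝ → 𝓢'(R3, ℂ)) : Prop :=
  ∀ t, 0 ≤ t → ∀ g : 𝓢(R3, ℂ),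
    HasDerivWithinAt (fun τ => (f τ : 𝓢'(R3, ℂ)) g) (F t g) (Set.Ici 0) t

/-- The unknown `(φ, u, v)` at a fixed time, or an initial datum. -/
structure State where
  φ : L2
  u : L2Vec
  v : L2Vec

/-- `‖(φ,u,v)‖_{L²} = ‖φ‖_{L²} + ‖u‖_{L²} + ‖v‖_{L²}`. -/
def State.norm (U : State) : ℝ := ‖U.φ‖ + ‖U.u‖ + ‖U.v‖

/-- `(φ,u,v) ∈ H^s(ℝ³)`. -/
def State.MemH (s : ℕ) (U : State) : Prop :=
  ENS.MemH s U.φ ∧ (∀ j, ENS.MemH s (U.u j)) ∧ ∀ j, ENS.MemH s (U.v j)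

/-- `(φ,u,v) ∈ L¹(ℝ³)`. -/
def State.MemL1 (U : State) : Prop :=
  Integrable (U.φ : R3 → ℂ) ∧ (∀ j, Integrable (U.u j : R3 → ℂ)) ∧
    ∀ j, Integrable (U.v j : R3 → ℂ)

/-- `U = (φ,u,v)` is a global solution, in `C([0,∞); H^s)`, of the linear Cauchy problem
`∂_t φ + div u = 0`, `∂_t u + ∇φ + u - v = 0`, `∂_t v + c v - c 𝒥u - Δv = 0`, `U(0) = U₀`.
For `s ≥ 2` the far-field condition `U(t,x) → 0` as `|x| → ∞` is part of `U(t) ∈ H^s(ℝ³)`.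
Only times `t ≥ 0` matter. -/
structure IsGlobalSolution (c : ℝ) (s : ℕ) (U₀ : State) (U : ℝ → State) : Prop where
  cont_φ : ContinuousInH s (fun t => (U t).φ)
  cont_u : ∀ j, ContinuousInH s (fun t => (U t).u j)
  cont_v : ∀ j, ContinuousInH s (fun t => (U t).v j)
  initial : U 0 = U₀
  eq_φ : HasTimeDeriv (fun t => (U t).φ) (fun t => -div (U t).u)
  eq_u : ∀ j, HasTimeDeriv (fun t => (U t).u j) (fun t =>
    -(∂_{e j} ((U t).φ : 𝓢'(R3, ℂ)) + ((U t).u j : 𝓢'(R3, ℂ)) - ((U t).v j : 𝓢'(R3, ℂ))))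
  eq_v : ∀ j, HasTimeDeriv (fun t => (U t).v j) (fun t =>
    -((c : ℂ) • ((U t).v j : 𝓢'(R3, ℂ)) - (c : ℂ) • (projJ (U t).u j : 𝓢'(R3, ℂ))
      - Δ ((U t).v j : 𝓢'(R3, ℂ))))

end ENS

end

/-! On the Fourier side the system is, at each frequency, a linear ODE in `ℂ^7`, solved by `flow`.
Write `k = 2π|ξ|`. Since `div v = 0` is preserved and the projected field is divergence free, the
energy `c|φ|² + c|u|² + |v|²` dissipates `2(c|u - v|² + k²|v|²)`. This misses `φ`. Adding the cross
term `2κ⟪u, ∇φ⟫` with `κ = δ/(1 + k²)` recovers it, and `ModeSystem.norm_sq_le` gives decay of each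
mode at a rate comparable to `k²/(1 + k²)`.

Upper bound (`exists_upper_bound`): integrable data have bounded Fourier transform, so low
frequencies contribute a Gaussian integral of size `t^(-3/2)`; high frequencies decay exponentially
times the `L²` mass of the data.

Lower bound (`exists_lower_bound`): as `v` is divergence free, `(1 + r)φ - div u` evolves exactly by
`exp(rt)` when `r² + r + k² = 0` (`ModeSystem.slow_mode`). The slow root satisfies `r ≥ -2k²` for
small `k`, and the initial value is bounded below because `φ̂₀` is, while `div u₀` is `O(k)`.
Integrating over a ball of radius of order `t^(-1/2)` gives `t^(-3/2)`. Square roots turn both into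
the exponent `-3/4`.

Existence (`exists_solution`) follows from the uniform mode bound and dominated convergence. For
uniqueness, `H^s` with `s ≥ 2` upgrades the distributional equation to an `L²`-valued ODE; cutting
off to `|ξ| ≤ R` makes the generator bounded, and `R` is then arbitrary. -/

namespace ENS

open Filter Topology Set

/-! ### Tempered distributions represented by functions of frequency -/

/-- The tempered distribution `T` is the inverse Fourier transform of the function `m`. -/
def FreqRep (T : 𝓢'(R3, ℂ)) (m : R3 → ℂ) : Prop :=
  ∀ g : 𝓢(R3, ℂ), Integrable (fun ξ => (𝓕⁻ g) ξ * m ξ) ∧ T g = ∫ ξ, (𝓕⁻ g) ξ * m ξ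

theorem integrable_schwartz_mul (g : 𝓢(R3, ℂ)) (f : L2) :
    Integrable (fun ξ => g ξ * f ξ) := by
  have h := (g.memLp 2 (volume : Measure R3)).integrable_mul (Lp.memLp f)
  exact h

theorem freqRep_lp (f : L2) : FreqRep (f : 𝓢'(R3, ℂ)) (𝓕 f : L2) := by
  intro g
  refine ⟨integrable_schwartz_mul _ _, ?_⟩
  have h : (f : 𝓢'(R3, ℂ)) g = (𝓕 (f : 𝓢'(R3, ℂ))) (𝓕⁻ g) := by simp
  rw [h, Lp.fourier_toTemperedDistribution_eq, Lp.toTemperedDistribution_apply]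
  rfl

namespace FreqRep

variable {T T' : 𝓢'(R3, ℂ)} {m m' : R3 → ℂ}

theorem add (h : FreqRep T m) (h' : FreqRep T' m') :
    FreqRep (T + T') (fun ξ => m ξ + m' ξ) := by
  intro g
  have e : (fun ξ => (𝓕⁻ g) ξ * (m ξ + m' ξ)) =
      fun ξ => (𝓕⁻ g) ξ * m ξ + (𝓕⁻ g) ξ * m' ξ := by
    ext ξ; ring
  rw [e]
  refine ⟨(h g).1.add (h' g).1, ?_⟩
  rw [integral_add (h g).1 (h' g).1, ← (h g).2, ← (h' g).2]
  rfl

theorem smul (a : ℂ) (h : FreqRep T m) : FreqRep (a • T) (fun ξ => a * m ξ) := by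
  intro g
  have e : (fun ξ => (𝓕⁻ g) ξ * (a * m ξ)) = fun ξ => a * ((𝓕⁻ g) ξ * m ξ) := by
    ext ξ; ring
  rw [e]
  refine ⟨(h g).1.const_mul a, ?_⟩
  rw [integral_const_mul, ← (h g).2]
  rfl

theorem neg (h : FreqRep T m) : FreqRep (-T) (fun ξ => -m ξ) := by
  have h1 := h.smul (-1)
  have h2 : (-1 : ℂ) • T = -T := by
    ext g
    exact neg_one_mul (T g)
  rw [h2] at h1
  simpa using h1

theorem sub (h : FreqRep T m) (h' : FreqRep T' m') :
    FreqRep (T - T') (fun ξ => m ξ - m' ξ) := by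
  simpa [sub_eq_add_neg] using h.add h'.neg

theorem zero : FreqRep 0 (fun _ => 0) := by
  intro g
  simp

theorem sum {ι : Type*} (s : Finset ι) {T : ι → 𝓢'(R3, ℂ)} {m : ι → R3 → ℂ}
    (h : ∀ i, FreqRep (T i) (m i)) : FreqRep (∑ i ∈ s, T i) (fun ξ => ∑ i ∈ s, m i ξ) := by
  classical
  induction s using Finset.induction_on with
  | empty => simpa using zero
  | insert a s ha ih => simpa [Finset.sum_insert ha] using (h a).add ih

theorem multiplier (h : FreqRep T m) {σ : R3 → ℂ} (hσ : σ.HasTemperateGrowth) :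
    FreqRep (TemperedDistribution.fourierMultiplierCLM ℂ σ T) (fun ξ => σ ξ * m ξ) := by
  intro g
  -- The multiplier is moved onto the test function.
  have h1 := h (𝓕 (SchwartzMap.smulLeftCLM ℂ σ (𝓕⁻ g)))
  have e : (fun ξ => (𝓕⁻ g) ξ * (σ ξ * m ξ)) = fun ξ =>
      (𝓕⁻ (𝓕 (SchwartzMap.smulLeftCLM ℂ σ (𝓕⁻ g)))) ξ * m ξ := by
    ext ξ
    rw [fourierInv_fourier_eq, SchwartzMap.smulLeftCLM_apply_apply hσ, smul_eq_mul]
    ring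
  rw [e]
  exact ⟨h1.1, by rw [← h1.2]; simp⟩

theorem lineDeriv (h : FreqRep T m) (j : Fin 3) :
    FreqRep (∂_{e j} T) (fun ξ => (2 * Real.pi * Complex.I) * (ξ j : ℂ) * m ξ) := by
  rw [TemperedDistribution.lineDeriv_eq_fourierMultiplierCLM]
  convert (h.multiplier (σ := fun ξ => ((inner ℝ ξ (e j) : ℝ) : ℂ)) (by fun_prop)).smul _
    using 2 with ξ
  have : (inner ℝ ξ (e j) : ℝ) = ξ j := by
    rw [e, EuclideanSpace.inner_single_right]
    simp
  rw [this]
  ring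

theorem laplacian (h : FreqRep T m) :
    FreqRep (Δ T) (fun ξ => -((2 * Real.pi) ^ 2 * ‖ξ‖ ^ 2 : ℝ) * m ξ) := by
  rw [TemperedDistribution.laplacian_eq_fourierMultiplierCLM]
  convert (h.multiplier (σ := fun ξ => ((‖ξ‖ ^ 2 : ℝ) : ℂ)) (by fun_prop)).smul
    (-(2 * Real.pi) ^ 2 : ℝ) using 2 with ξ
  · ext g
    exact Complex.real_smul
  · push_cast
    ring

theorem congr_ae (h : FreqRep T m) (hm : m =ᵐ[volume] m') : FreqRep T m' := by
  intro g
  have e : (fun ξ => (𝓕⁻ g) ξ * m ξ) =ᵐ[volume] fun ξ => (𝓕⁻ g) ξ * m' ξ := by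
    filter_upwards [hm] with ξ hξ
    rw [hξ]
  exact ⟨(h g).1.congr e, by rw [(h g).2, integral_congr_ae e]⟩

theorem unique (h : FreqRep T m) (h' : FreqRep T' m) : T = T' := by
  ext g
  rw [(h g).2, (h' g).2]

/-- Every smooth compactly supported function is the inverse Fourier transform of a Schwartz
function, so the fundamental lemma of the calculus of variations applies. -/
theorem ae_eq (h : FreqRep T m) (h' : FreqRep T m') (hm : LocallyIntegrable m)
    (hm' : LocallyIntegrable m') : m =ᵐ[volume] m' := by
  refine ae_eq_of_integral_contDiff_smul_eq hm hm' fun g g_smooth g_cpt => ?_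
  have hg₁ : HasCompactSupport (Complex.ofRealCLM ∘ g) := g_cpt.comp_left rfl
  have hg₂ : ContDiff ℝ (⊤ : ℕ∞) (Complex.ofRealCLM ∘ g) := by fun_prop
  have e := (h (𝓕 (hg₁.toSchwartzMap hg₂))).2.symm.trans (h' (𝓕 (hg₁.toSchwartzMap hg₂))).2
  simpa using e

end FreqRep

theorem L2.locallyIntegrable (f : L2) : LocallyIntegrable (f : R3 → ℂ) :=
  (Lp.memLp f).locallyIntegrable (by norm_num)

/-! ### Sobolev regularity, Riesz operators and integrable data in frequency -/

/-- The symbol of the Bessel potential of order `s`. -/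
noncomputable def bessel (s : ℕ) (ξ : R3) : ℝ := (1 + ‖ξ‖ ^ 2) ^ ((s : ℝ) / 2)

theorem bessel_pos (s : ℕ) (ξ : R3) : 0 < bessel s ξ := by
  unfold bessel; positivity

theorem continuous_bessel (s : ℕ) : Continuous (bessel s) := by
  unfold bessel
  exact Continuous.rpow_const (by fun_prop) fun ξ => Or.inl (by positivity)

theorem one_add_norm_sq_le_bessel {s : ℕ} (hs : 2 ≤ s) (ξ : R3) : 1 + ‖ξ‖ ^ 2 ≤ bessel s ξ := by
  unfold bessel
  have h2 : (2 : ℝ) ≤ s := by exact_mod_cast hs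
  calc 1 + ‖ξ‖ ^ 2 = (1 + ‖ξ‖ ^ 2) ^ (1 : ℝ) := (Real.rpow_one _).symm
    _ ≤ _ := Real.rpow_le_rpow_of_exponent_le (by nlinarith [norm_nonneg ξ]) (by linarith)

theorem besselPotential_eq_iff (s : ℕ) (f w : L2) :
    TemperedDistribution.besselPotential R3 ℂ (s : ℝ) (f : 𝓢'(R3, ℂ)) = (w : 𝓢'(R3, ℂ)) ↔
      (𝓕 w : L2) =ᵐ[volume] fun ξ => (bessel s ξ : ℂ) * (𝓕 f : L2) ξ := by
  have h1 : FreqRep (TemperedDistribution.besselPotential R3 ℂ (s : ℝ) (f : 𝓢'(R3, ℂ)))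
      (fun ξ => (bessel s ξ : ℂ) * (𝓕 f : L2) ξ) :=
    (freqRep_lp f).multiplier (σ := fun ξ => (bessel s ξ : ℂ)) (by unfold bessel; fun_prop)
  constructor
  · intro h
    rw [h] at h1
    refine (freqRep_lp w).ae_eq h1 (L2.locallyIntegrable _) ?_
    have := (L2.locallyIntegrable (𝓕 f : L2)).continuous_smul (g := fun ξ => (bessel s ξ : ℂ)) (𝕜 := ℂ)
      (by have := continuous_bessel s; fun_prop)
    simpa using this
  · intro h
    exact h1.unique ((freqRep_lp w).congr_ae h)

theorem fourier_riesz (j k : Fin 3) (f : L2) :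
    (𝓕 (riesz j k f) : L2) =ᵐ[volume] fun ξ => rieszSymbol j k ξ * (𝓕 f : L2) ξ := by
  rw [riesz, fourier_fourierInv_eq]
  exact MemLp.coeFn_toLp _

theorem freqRep_projJ (u : L2Vec) (j : Fin 3) :
    FreqRep (projJ u j : 𝓢'(R3, ℂ)) (fun ξ => (𝓕 (u j) : L2) ξ +
      ∑ k : Fin 3, rieszSymbol j k ξ * (𝓕 (u k) : L2) ξ) := by
  have h : (projJ u j : 𝓢'(R3, ℂ)) = (u j : 𝓢'(R3, ℂ)) +
      ∑ k : Fin 3, (riesz j k (u k) : 𝓢'(R3, ℂ)) := by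
    simp only [← Lp.toTemperedDistributionCLM_apply, projJ, map_add, map_sum]
  rw [h]
  exact (freqRep_lp _).add (FreqRep.sum _ fun k => (freqRep_lp _).congr_ae (fourier_riesz j k _))

/-- Both transforms satisfy the same duality `∫ h f̂ = ∫ ĥ f`: one by its definition on
distributions, the other by Fubini. -/
theorem fourier_ae_eq_of_integrable (f : L2) (hf : Integrable (f : R3 → ℂ)) :
    (𝓕 f : L2) =ᵐ[volume] 𝓕 (f : R3 → ℂ) := by
  have hc : Continuous (𝓕 (f : R3 → ℂ)) :=
    VectorFourier.fourierIntegral_continuous Real.continuous_fourierChar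
      (by exact continuous_inner) hf
  refine ae_eq_of_integral_contDiff_smul_eq (L2.locallyIntegrable _) hc.locallyIntegrable
    fun g g_smooth g_cpt => ?_
  have hg₁ : HasCompactSupport (Complex.ofRealCLM ∘ g) := g_cpt.comp_left rfl
  have hg₂ : ContDiff ℝ (⊤ : ℕ∞) (Complex.ofRealCLM ∘ g) := by fun_prop
  set h := hg₁.toSchwartzMap hg₂
  have hh : ∀ ξ, h ξ = (g ξ : ℂ) := fun ξ => rfl
  have h1 : ∫ ξ, h ξ • (𝓕 f : L2) ξ = ∫ x, (𝓕 h) x • f x := by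
    rw [← Lp.toTemperedDistribution_apply, ← Lp.toTemperedDistribution_apply,
      ← Lp.fourier_toTemperedDistribution_eq]
    simp
  have h2 : ∫ x, (𝓕 h) x • f x = ∫ ξ, h ξ • 𝓕 (f : R3 → ℂ) ξ := by
    have := VectorFourier.integral_fourierIntegral_smul_eq_flip (μ := volume) (ν := volume)
      (L := innerₗ R3) Real.continuous_fourierChar continuous_inner h.integrable hf
    rw [flip_innerₗ] at this
    exact this
  exact h1.trans h2

/-- Passing between the two normalizations rescales frequency by `2π`; this is why `2π|ξ|` is the
effective wave number throughout. -/
theorem ft_eq (f : R3 → ℂ) (ξ : R3) :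
    ft f ξ = (((2 * Real.pi) ^ (-(3 / 2) : ℝ) : ℝ) : ℂ) * 𝓕 f ((2 * Real.pi)⁻¹ • ξ) := by
  rw [ft, Real.fourier_eq']
  congr 2
  ext x
  rw [inner_smul_right, smul_eq_mul, mul_comm]
  congr 2
  have : (Real.pi : ℂ) ≠ 0 := by exact_mod_cast Real.pi_ne_zero
  push_cast
  field_simp

theorem norm_fourier_le_integral (f : R3 → ℂ) (ξ : R3) : ‖𝓕 f ξ‖ ≤ ∫ x, ‖f x‖ :=
  VectorFourier.norm_fourierIntegral_le_integral_norm _ _ _ _ _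

theorem sum_mul_fourier_eq_zero_of_div_eq_zero (v : L2Vec) (hv : div v = 0) :
    ∀ᵐ ξ : R3, ∑ j, (ξ j : ℂ) * (𝓕 (v j) : L2) ξ = 0 := by
  have h1 : FreqRep (div v) fun ξ => ∑ j : Fin 3,
      (2 * Real.pi * Complex.I) * (ξ j : ℂ) * (𝓕 (v j) : L2) ξ :=
    FreqRep.sum _ fun j => (freqRep_lp (v j)).lineDeriv j
  rw [hv] at h1
  have h2 := h1.ae_eq FreqRep.zero ?_ (continuous_const.locallyIntegrable)
  · filter_upwards [h2] with ξ hξ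
    simp only [mul_assoc, ← Finset.mul_sum] at hξ
    simpa [Real.pi_ne_zero] using hξ
  · have := locallyIntegrable_finsetSum Finset.univ
      (f := fun (j : Fin 3) ξ => (2 * Real.pi * Complex.I) * (ξ j : ℂ) * (𝓕 (v j) : L2) ξ)
      (μ := (volume : Measure R3)) fun j _ => by
        simpa using (L2.locallyIntegrable (𝓕 (v j) : L2)).continuous_smul (𝕜 := ℂ)
          (g := fun ξ : R3 => (2 * Real.pi * Complex.I) * (ξ j : ℂ)) (by fun_prop)
    simpa using this

theorem L2.norm_sq_eq (f : L2) : ‖f‖ ^ 2 = ∫ ξ, ‖f ξ‖ ^ 2 := by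
  have h : inner ℂ f f = ∫ ξ, inner ℂ (f ξ) (f ξ) := MeasureTheory.L2.inner_def f f
  rw [inner_self_eq_norm_sq_to_K] at h
  have h2 : ∀ ξ, inner ℂ (f ξ) (f ξ) = ((‖f ξ‖ ^ 2 : ℝ) : ℂ) := by
    intro ξ
    rw [inner_self_eq_norm_sq_to_K]
    simp
  simp_rw [h2] at h
  rw [integral_complex_ofReal] at h
  have h3 : ((‖f‖ ^ 2 : ℝ) : ℂ) = ((∫ ξ, ‖f ξ‖ ^ 2 : ℝ) : ℂ) := by
    rw [← h]; simp
  exact_mod_cast h3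

theorem L2.integrable_norm_sq (f : L2) : Integrable (fun ξ => ‖f ξ‖ ^ 2) :=
  (Lp.memLp f).integrable_norm_pow (by norm_num)

/-! ### Dominated convergence on the half-line -/

/-- Differentiation under the integral sign on the half-line `[0, ∞)`. -/
theorem hasDerivWithinAt_integral_Ici {α : Type*} [MeasurableSpace α] {μ : Measure α}
    {F F' : ℝ → α → ℂ} {B : α → ℝ} (hF : ∀ t, 0 ≤ t → Integrable (F t) μ) (hB : Integrable B μ)
    (hd : ∀ᵐ a ∂μ, ∀ t, 0 ≤ t → HasDerivWithinAt (fun τ => F τ a) (F' t a) (Ici 0) t)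
    (hb : ∀ᵐ a ∂μ, ∀ t, 0 ≤ t → ‖F' t a‖ ≤ B a) {t : ℝ} (ht : 0 ≤ t) :
    HasDerivWithinAt (fun τ => ∫ a, F τ a ∂μ) (∫ a, F' t a ∂μ) (Ici 0) t := by
  rw [hasDerivWithinAt_iff_tendsto_slope]
  have hmem : ∀ᶠ τ in 𝓝[Ici 0 \ {t}] t, τ ∈ Ici (0 : ℝ) \ {t} := self_mem_nhdsWithin
  have key : Tendsto (fun τ => ∫ a, slope (fun τ => F τ a) t τ ∂μ) (𝓝[Ici 0 \ {t}] t)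
      (𝓝 (∫ a, F' t a ∂μ)) := by
    refine tendsto_integral_filter_of_dominated_convergence B ?_ ?_ hB ?_
    · filter_upwards [hmem] with τ hτ
      simp only [slope_def_module]
      exact (((hF τ hτ.1).sub (hF t ht)).smul ((τ - t)⁻¹)).aestronglyMeasurable
    · filter_upwards [hmem] with τ hτ
      filter_upwards [hd, hb] with a hda hba
      -- The mean value inequality bounds all difference quotients by `B`, uniformly in time.
      have h := (convex_Ici (0 : ℝ)).norm_image_sub_le_of_norm_hasDerivWithin_le
        (fun x hx => hda x hx) (fun x hx => hba x hx) (mem_Ici.2 ht) hτ.1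
      have hne : 0 < ‖τ - t‖ := norm_pos_iff.2 (sub_ne_zero.2 hτ.2)
      rw [slope_def_module, norm_smul, norm_inv, inv_mul_le_iff₀ hne, mul_comm]
      exact h
    · filter_upwards [hd] with a hda
      exact hasDerivWithinAt_iff_tendsto_slope.1 (hda t ht)
  refine key.congr' ?_
  filter_upwards [hmem] with τ hτ
  simp only [slope_def_module]
  rw [integral_smul, integral_sub (hF τ hτ.1) (hF t ht)]

/-- A pointwise continuous curve dominated by a square integrable function is continuous
in `L²`. -/
theorem continuousOn_L2_of_dominated {w : ℝ → L2} {y : ℝ → R3 → ℂ} {B : R3 → ℝ}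
    (hw : ∀ t, 0 ≤ t → (w t : R3 → ℂ) =ᵐ[volume] y t)
    (hB : Integrable fun ξ => B ξ ^ 2)
    (hb : ∀ᵐ ξ, ∀ t, 0 ≤ t → ‖y t ξ‖ ≤ B ξ)
    (hc : ∀ᵐ ξ, ContinuousOn (fun t => y t ξ) (Ici 0)) : ContinuousOn w (Ici 0) := by
  intro t ht
  have hmem : ∀ᶠ τ in 𝓝[Ici 0] t, τ ∈ Ici (0 : ℝ) := self_mem_nhdsWithin
  have hm : ∀ τ, 0 ≤ τ → AEStronglyMeasurable (y τ) volume := fun τ hτ =>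
    (Lp.aestronglyMeasurable (w τ)).congr (hw τ hτ)
  have key : Tendsto (fun τ => ∫ ξ, ‖y τ ξ - y t ξ‖ ^ 2) (𝓝[Ici 0] t)
      (𝓝 (∫ _ : R3, (0 : ℝ))) := by
    refine tendsto_integral_filter_of_dominated_convergence (fun ξ => 4 * B ξ ^ 2) ?_ ?_
      (hB.const_mul 4) ?_
    · filter_upwards [hmem] with τ hτ
      exact ((hm τ hτ).sub (hm t ht)).norm.pow 2
    · filter_upwards [hmem] with τ hτ
      filter_upwards [hb] with ξ hξ
      rw [norm_pow, norm_norm]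
      have h1 : ‖y τ ξ - y t ξ‖ ≤ 2 * B ξ := by
        linarith [norm_sub_le (y τ ξ) (y t ξ), hξ τ hτ, hξ t ht]
      calc _ ≤ (2 * B ξ) ^ 2 := by gcongr
        _ = _ := by ring
    · filter_upwards [hc] with ξ hξ
      have h1 : Tendsto (fun τ => ‖y τ ξ - y t ξ‖ ^ 2) (𝓝[Ici 0] t) (𝓝 (‖y t ξ - y t ξ‖ ^ 2)) :=
        (((hξ t ht).sub tendsto_const_nhds).norm).pow 2
      simpa using h1
  have key2 : Tendsto (fun τ => ‖w τ - w t‖ ^ 2) (𝓝[Ici 0] t) (𝓝 0) := by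
    rw [integral_zero] at key
    refine key.congr' ?_
    filter_upwards [hmem] with τ hτ
    rw [L2.norm_sq_eq]
    refine integral_congr_ae ?_
    filter_upwards [hw τ hτ, hw t ht, Lp.coeFn_sub (w τ) (w t)] with ξ h1 h2 h3
    rw [h3, Pi.sub_apply, h1, h2]
  have key3 := key2.sqrt
  simp only [Real.sqrt_sq (norm_nonneg _), Real.sqrt_zero] at key3
  exact tendsto_iff_norm_sub_tendsto_zero.2 key3

/-! ### Matrix exponentials -/

section Flow

variable {ι : Type*} [Fintype ι] [DecidableEq ι]

/-- The operator on `ℂ^ι` with the given matrix entries. -/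
noncomputable def toOp (m : ι → ι → ℂ) : (ι → ℂ) →L[ℂ] (ι → ℂ) :=
  ∑ i, ∑ j, m i j • (ContinuousLinearMap.single ℂ (fun _ : ι => ℂ) i).comp
    (ContinuousLinearMap.proj j)

theorem toOp_apply (m : ι → ι → ℂ) (y : ι → ℂ) (i : ι) : toOp m y i = ∑ j, m i j * y j := by
  simp [toOp, Pi.single_apply]

theorem continuous_toOp : Continuous (toOp : (ι → ι → ℂ) → (ι → ℂ) →L[ℂ] (ι → ℂ)) := by
  unfold toOp
  fun_prop

/-- The solution at time `t` of the linear system `y' = m y` with initial value `y`. -/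
noncomputable def flow (m : ι → ι → ℂ) (t : ℝ) (y : ι → ℂ) : ι → ℂ :=
  NormedSpace.exp (t • toOp m) y

theorem flow_zero (m : ι → ι → ℂ) (y : ι → ℂ) : flow m 0 y = y := by
  rw [flow, zero_smul ℝ (toOp m), NormedSpace.exp_zero]
  rfl

theorem hasDerivAt_flow (m : ι → ι → ℂ) (y : ι → ℂ) (t : ℝ) :
    HasDerivAt (fun τ => flow m τ y) (toOp m (flow m t y)) t := by
  have h := hasDerivAt_exp_smul_const' (toOp m) t
  have h2 := ((ContinuousLinearMap.apply ℂ (ι → ℂ) y).restrictScalars ℝ).hasFDerivAt.comp_hasDerivAt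
    t h
  exact h2

theorem hasDerivAt_flow_apply (m : ι → ι → ℂ) (y : ι → ℂ) (t : ℝ) (i : ι) :
    HasDerivAt (fun τ => flow m τ y i) (∑ j, m i j * flow m t y j) t := by
  have h := hasDerivAt_pi.1 (hasDerivAt_flow m y t) i
  rwa [toOp_apply] at h

/-- Joint continuity in matrix and datum yields measurability in `ξ` after composition with a symbol
that is only measurable (it jumps at `ξ = 0`). -/
theorem continuous_flow (t : ℝ) :
    Continuous fun p : (ι → ι → ℂ) × (ι → ℂ) => flow p.1 t p.2 := by
  unfold flow
  let _ : NormedAlgebra ℚ ((ι → ℂ) →L[ℂ] (ι → ℂ)) := NormedAlgebra.restrictScalars ℚ ℂ _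
  have h1 : Continuous fun p : (ι → ι → ℂ) × (ι → ℂ) => NormedSpace.exp (t • toOp p.1) :=
    NormedSpace.exp_continuous.comp ((continuous_toOp.comp continuous_fst).const_smul t)
  exact h1.clm_apply continuous_snd

end Flow

/-! ### Lyapunov functional for one frequency -/

section Lyapunov

variable {F H : Type*} [NormedAddCommGroup F] [InnerProductSpace ℝ F]
  [NormedAddCommGroup H] [InnerProductSpace ℝ H]

local notation "⟪" x ", " y "⟫" => inner ℝ x y

theorem le_exp_mul_of_hasDerivAt_le {L L' : ℝ → ℝ} {a : ℝ} (hL : ∀ t, HasDerivAt L (L' t) t)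
    (h : ∀ t, L' t ≤ -(a * L t)) {t : ℝ} (ht : 0 ≤ t) : L t ≤ Real.exp (-(a * t)) * L 0 := by
  have hd : ∀ t, HasDerivAt (fun t => Real.exp (a * t) * L t)
      (Real.exp (a * t) * (a * 1) * L t + Real.exp (a * t) * L' t) t := fun t =>
    (((hasDerivAt_id t).const_mul a).exp).mul (hL t)
  have hanti : Antitone fun t => Real.exp (a * t) * L t := by
    refine antitone_of_hasDerivAt_nonpos hd fun t => ?_
    have := mul_nonneg (Real.exp_pos (a * t)).le (sub_nonneg.2 (h t))
    change _ ≤ (0 : ℝ)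
    linarith
  have h1 := hanti ht
  simp only [mul_zero, Real.exp_zero, one_mul] at h1
  rw [Real.exp_neg, inv_mul_eq_div, le_div_iff₀ (Real.exp_pos _), mul_comm]
  exact h1

/-- The abstract form of the system for a single frequency of size `k`: `D` is the divergence, `G`
the gradient, and `P` the projection of `u`, of which only `⟪v, P⟫ = ⟪v, u⟫` matters. -/
structure ModeSystem (c k : ℝ) (G : F →L[ℝ] H) (D : H →L[ℝ] F) (φ : ℝ → F) (u v : ℝ → H)
    (P : ℝ → H) : Prop where
  skew : ∀ f w, ⟪G f, w⟫ = -⟪f, D w⟫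
  norm_grad : ∀ f, ‖G f‖ = k * ‖f‖
  deriv_φ : ∀ t, HasDerivAt φ (-D (u t)) t
  deriv_u : ∀ t, HasDerivAt u (-G (φ t) - u t + v t) t
  deriv_v : ∀ t, HasDerivAt v (-(c + k ^ 2) • v t + c • P t) t
  div_v : ∀ t, D (v t) = 0
  inner_P : ∀ t, ⟪v t, P t⟫ = ⟪v t, u t⟫

namespace ModeSystem

variable {c k : ℝ} {G : F →L[ℝ] H} {D : H →L[ℝ] F} {φ : ℝ → F} {u v P : ℝ → H}

/-- `D` is minus the adjoint of `G`, so it inherits the bound of `G`. -/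
theorem norm_div_le (hk : 0 ≤ k) (S : ModeSystem c k G D φ u v P) (w : H) :
    ‖D w‖ ≤ k * ‖w‖ := by
  have h1 : ‖D w‖ * ‖D w‖ ≤ k * ‖w‖ * ‖D w‖ := by
    calc ‖D w‖ * ‖D w‖ = ⟪D w, D w⟫ := (real_inner_self_eq_norm_mul_norm _).symm
      _ = -⟪G (D w), w⟫ := by rw [S.skew]; ring
      _ ≤ ‖G (D w)‖ * ‖w‖ := (neg_le_abs _).trans (abs_real_inner_le_norm _ _)
      _ = _ := by rw [S.norm_grad]; ring
  by_cases h0 : ‖D w‖ = 0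
  · rw [h0]; positivity
  · exact le_of_mul_le_mul_right h1 (lt_of_le_of_ne (norm_nonneg _) (Ne.symm h0))

/-- Polarization of `‖G f‖ = k‖f‖`, followed by skew-adjointness. -/
theorem div_grad (S : ModeSystem c k G D φ u v P) (f : F) : D (G f) = -(k ^ 2 • f) := by
  have h (f g : F) : ⟪G f, G g⟫ = k ^ 2 * ⟪f, g⟫ := by
    rw [real_inner_eq_norm_add_mul_self_sub_norm_mul_self_sub_norm_mul_self_div_two,
      real_inner_eq_norm_add_mul_self_sub_norm_mul_self_sub_norm_mul_self_div_two, ← map_add]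
    simp only [S.norm_grad]
    ring
  refine ext_inner_left ℝ fun g => ?_
  rw [← neg_eq_iff_eq_neg.2 (S.skew g (G f)), h, inner_neg_right, inner_smul_right]

/-- The acoustic terms cancel by skewness. The weight `c` on `φ` and `u` matches the coupling in the
`v` equation, so the drag terms complete the square `c‖u - v‖²`. -/
theorem hasDerivAt_energy (S : ModeSystem c k G D φ u v P) (t : ℝ) :
    HasDerivAt (fun t => c * ‖φ t‖ ^ 2 + c * ‖u t‖ ^ 2 + ‖v t‖ ^ 2)
      (-2 * (c * ‖u t - v t‖ ^ 2 + k ^ 2 * ‖v t‖ ^ 2)) t := by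
  have h := (((S.deriv_φ t).norm_sq.const_mul c).add ((S.deriv_u t).norm_sq.const_mul c)).add
    (S.deriv_v t).norm_sq
  refine h.congr_deriv ?_
  rw [norm_sub_sq_real]
  simp only [inner_add_right, inner_sub_right, inner_neg_right, inner_smul_right, S.inner_P,
    real_inner_self_eq_norm_sq, real_inner_comm (G (φ t)), S.skew]
  rw [real_inner_comm (u t) (v t)]
  ring

/-- This supplies the damping of `φ` that the energy lacks. Because `D v = 0`, the bad term involves
only `u - v`, which the energy dissipates. -/
theorem hasDerivAt_cross (S : ModeSystem c k G D φ u v P) (t : ℝ) :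
    HasDerivAt (fun t => ⟪u t, G (φ t)⟫)
      (-(k ^ 2 * ‖φ t‖ ^ 2) - ⟪u t - v t, G (φ t)⟫ + ‖D (u t - v t)‖ ^ 2) t := by
  have h := (S.deriv_u t).inner ℝ (G.hasFDerivAt.comp_hasDerivAt t (S.deriv_φ t))
  refine h.congr_deriv ?_
  have h1 : ‖G (φ t)‖ ^ 2 = k ^ 2 * ‖φ t‖ ^ 2 := by rw [S.norm_grad]; ring
  rw [← h1, map_sub, S.div_v, sub_zero, map_neg, inner_neg_right, real_inner_comm, S.skew]
  simp only [inner_add_left, inner_sub_left, inner_neg_left, real_inner_self_eq_norm_sq,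
    Function.comp_apply]
  ring

/-- Exponential decay of a mode at the rate `k² / (1 + k²)`. -/
theorem norm_sq_le (hc : 0 < c) (hk : 0 ≤ k) {δ : ℝ} (hδ : 0 < δ) (hδc : 2 * δ ≤ c)
    (hδ1 : δ ≤ 1) (S : ModeSystem c k G D φ u v P) {t : ℝ} (ht : 0 ≤ t) :
    ‖φ t‖ ^ 2 + ‖u t‖ ^ 2 + ‖v t‖ ^ 2 ≤ (3 * c + 1) / δ *
      Real.exp (-(δ / (3 * c + 1) * (k ^ 2 / (1 + k ^ 2)) * t)) *
        (‖φ 0‖ ^ 2 + ‖u 0‖ ^ 2 + ‖v 0‖ ^ 2) := by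
  -- The factor `1/(1 + k²)` makes the cross term harmless at every frequency: `2κk ≤ δ` keeps it
  -- below the energy, and `κ(1 + k²) = δ` lets the dissipation absorb its error.
  set κ := δ / (1 + k ^ 2) with hκ
  set q := k ^ 2 / (1 + k ^ 2) with hq
  have hκ0 : 0 < κ := by positivity
  have hq0 : 0 ≤ q := by positivity
  have hq1 : q ≤ 1 := by rw [hq, div_le_one (by positivity)]; linarith
  have hqk : q ≤ k ^ 2 := by
    rw [hq, div_le_iff₀ (by positivity)]; nlinarith [sq_nonneg (k ^ 2)]
  have hκq : κ * k ^ 2 = δ * q := by rw [hκ, hq]; ring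
  have hκδ : κ * (1 + k ^ 2) = δ := by rw [hκ]; field_simp
  set N : ℝ → ℝ := fun t => ‖φ t‖ ^ 2 + ‖u t‖ ^ 2 + ‖v t‖ ^ 2 with hN
  set L : ℝ → ℝ := fun t => (c * ‖φ t‖ ^ 2 + c * ‖u t‖ ^ 2 + ‖v t‖ ^ 2) +
    2 * κ * ⟪u t, G (φ t)⟫ with hL
  have hX : ∀ t, |2 * κ * ⟪u t, G (φ t)⟫| ≤ δ * (‖φ t‖ ^ 2 + ‖u t‖ ^ 2) := by
    intro t
    have h1 := abs_real_inner_le_norm (u t) (G (φ t))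
    rw [S.norm_grad] at h1
    rw [abs_mul, abs_of_pos (by positivity)]
    calc 2 * κ * |⟪u t, G (φ t)⟫| ≤ 2 * κ * (‖u t‖ * (k * ‖φ t‖)) := by gcongr
      _ = κ * (2 * k) * (‖u t‖ * ‖φ t‖) := by ring
      _ ≤ κ * (1 + k ^ 2) * (‖φ t‖ ^ 2 + ‖u t‖ ^ 2) := by
        gcongr
        · nlinarith [sq_nonneg (k - 1)]
        · nlinarith [sq_nonneg (‖u t‖ - ‖φ t‖), sq_nonneg ‖u t‖, sq_nonneg ‖φ t‖]
      _ = _ := by rw [hκδ]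
  have hLlow : ∀ t, δ * N t ≤ L t := by
    intro t
    have := (abs_le.1 (hX t)).1
    simp only [hN, hL]
    nlinarith [sq_nonneg ‖φ t‖, sq_nonneg ‖u t‖, sq_nonneg ‖v t‖,
      mul_nonneg (sub_nonneg.2 hδc) (add_nonneg (sq_nonneg ‖φ t‖) (sq_nonneg ‖u t‖)),
      mul_nonneg (sub_nonneg.2 hδ1) (sq_nonneg ‖v t‖)]
  have hLup : ∀ t, L t ≤ (3 * c + 1) * N t := by
    intro t
    have := (abs_le.1 (hX t)).2
    simp only [hN, hL]
    nlinarith [mul_nonneg (sub_nonneg.2 hδc) (add_nonneg (sq_nonneg ‖φ t‖) (sq_nonneg ‖u t‖)),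
      mul_nonneg hc.le (sq_nonneg ‖φ t‖), mul_nonneg hc.le (sq_nonneg ‖u t‖),
      mul_nonneg hc.le (sq_nonneg ‖v t‖), sq_nonneg ‖φ t‖, sq_nonneg ‖u t‖]
  -- The dissipation controls `u - v` and `v`, so `L` has to be bounded in those variables; `2(c +
  -- δ) ≤ 3c` gives the constant.
  have hLup' : ∀ t, L t ≤ (3 * c + 1) * (‖φ t‖ ^ 2 + ‖u t - v t‖ ^ 2 + ‖v t‖ ^ 2) := by
    intro t
    have h1 := (abs_le.1 (hX t)).2
    have h2 : ‖u t‖ ^ 2 ≤ 2 * (‖u t - v t‖ ^ 2 + ‖v t‖ ^ 2) := by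
      have h3 : ‖u t‖ ≤ ‖u t - v t‖ + ‖v t‖ := by
        simpa using norm_add_le (u t - v t) (v t)
      calc ‖u t‖ ^ 2 ≤ (‖u t - v t‖ + ‖v t‖) ^ 2 := by gcongr
        _ ≤ _ := by nlinarith [sq_nonneg (‖u t - v t‖ - ‖v t‖)]
    simp only [hL]
    have h4 : (c + δ) * ‖u t‖ ^ 2 ≤ (c + δ) * (2 * (‖u t - v t‖ ^ 2 + ‖v t‖ ^ 2)) := by gcongr
    nlinarith [mul_nonneg (sub_nonneg.2 hδc) (sq_nonneg ‖φ t‖),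
      mul_nonneg (sub_nonneg.2 hδc) (sq_nonneg ‖u t - v t‖),
      mul_nonneg (sub_nonneg.2 hδc) (sq_nonneg ‖v t‖),
      mul_nonneg hc.le (sq_nonneg ‖φ t‖), mul_nonneg hc.le (sq_nonneg ‖u t - v t‖),
      mul_nonneg hc.le (sq_nonneg ‖v t‖), sq_nonneg ‖φ t‖, sq_nonneg ‖u t - v t‖]
  have hderiv : ∀ t, HasDerivAt L (-2 * (c * ‖u t - v t‖ ^ 2 + k ^ 2 * ‖v t‖ ^ 2) +
      2 * κ * (-(k ^ 2 * ‖φ t‖ ^ 2) - ⟪u t - v t, G (φ t)⟫ + ‖D (u t - v t)‖ ^ 2)) t := fun t =>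
    (S.hasDerivAt_energy t).add ((S.hasDerivAt_cross t).const_mul (2 * κ))
  have hdecay : ∀ t, -2 * (c * ‖u t - v t‖ ^ 2 + k ^ 2 * ‖v t‖ ^ 2) +
      2 * κ * (-(k ^ 2 * ‖φ t‖ ^ 2) - ⟪u t - v t, G (φ t)⟫ + ‖D (u t - v t)‖ ^ 2) ≤
      -(δ / (3 * c + 1) * q * L t) := by
    intro t
    set a := ‖u t - v t‖ with ha
    set b := ‖v t‖
    set f := ‖φ t‖
    have h1 : -⟪u t - v t, G (φ t)⟫ ≤ a * (k * f) := by
      have := (neg_le_abs _).trans (abs_real_inner_le_norm (u t - v t) (G (φ t)))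
      rwa [S.norm_grad] at this
    have h2 : ‖D (u t - v t)‖ ^ 2 ≤ (k * a) ^ 2 := by
      have := S.norm_div_le hk (u t - v t)
      gcongr
    -- Young's inequality spends half of `k²f²` on the product `a(kf)`.
    have h3 : 2 * κ * (-(k ^ 2 * f ^ 2) - ⟪u t - v t, G (φ t)⟫ + ‖D (u t - v t)‖ ^ 2) ≤
        2 * κ * (-(k ^ 2 * f ^ 2) / 2 + (1 + k ^ 2) * a ^ 2) := by
      refine mul_le_mul_of_nonneg_left ?_ (by positivity)
      nlinarith [sq_nonneg (a - k * f), sq_nonneg a]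
    have h4 : 2 * κ * (-(k ^ 2 * f ^ 2) / 2 + (1 + k ^ 2) * a ^ 2) =
        -(δ * q * f ^ 2) + 2 * δ * a ^ 2 := by
      linear_combination (-f ^ 2) * hκq + (2 * a ^ 2) * hκδ
    have h5 : δ / (3 * c + 1) * q * L t ≤ δ * q * (f ^ 2 + a ^ 2 + b ^ 2) := by
      calc δ / (3 * c + 1) * q * L t
          ≤ δ / (3 * c + 1) * q * ((3 * c + 1) * (f ^ 2 + a ^ 2 + b ^ 2)) := by
            gcongr; exact hLup' t
        _ = _ := by field_simp
    -- The rate `q` is at most `1` for the `u - v` part and at most `k²` for the `v` part, matching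
    -- the two dissipation terms.
    have h6 : δ * q * a ^ 2 ≤ δ * 1 * a ^ 2 := by gcongr
    have h7 : δ * q * b ^ 2 ≤ 1 * k ^ 2 * b ^ 2 := by gcongr
    nlinarith [mul_nonneg (sub_nonneg.2 hδc) (sq_nonneg a), mul_nonneg (sq_nonneg k) (sq_nonneg b),
      mul_nonneg hδ.le (sq_nonneg a)]
  have hfin := le_exp_mul_of_hasDerivAt_le hderiv hdecay ht
  have h0 := hLup 0
  have h1 : δ * N t ≤ Real.exp (-(δ / (3 * c + 1) * q * t)) * ((3 * c + 1) * N 0) :=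
    (hLlow t).trans (hfin.trans (by gcongr))
  calc N t = δ⁻¹ * (δ * N t) := by field_simp
    _ ≤ δ⁻¹ * (Real.exp (-(δ / (3 * c + 1) * q * t)) * ((3 * c + 1) * N 0)) := by gcongr
    _ = _ := by ring

/-- The slow mode: a left eigenvector of the acoustic part evolves by its eigenvalue. -/
theorem slow_mode (S : ModeSystem c k G D φ u v P) {r : ℝ} (hr : r ^ 2 + r + k ^ 2 = 0) (t : ℝ) :
    (1 + r) • φ t - D (u t) = Real.exp (r * t) • ((1 + r) • φ 0 - D (u 0)) := by
  have hd : ∀ t, HasDerivAt (fun t => Real.exp (-(r * t)) • ((1 + r) • φ t - D (u t))) 0 t := by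
    intro t
    have h1 : HasDerivAt (fun t => (1 + r) • φ t - D (u t))
        ((1 + r) • (-D (u t)) - D (-G (φ t) - u t + v t)) t :=
      ((S.deriv_φ t).const_smul (1 + r)).sub (D.hasFDerivAt.comp_hasDerivAt t (S.deriv_u t))
    have h2 : HasDerivAt (fun t => Real.exp (-(r * t))) (Real.exp (-(r * t)) * -(r * 1)) t :=
      (((hasDerivAt_id t).const_mul r).neg).exp
    refine (h2.smul h1).congr_deriv ?_
    -- With `k² = -r(1 + r)`, the derivative `-r D u - k²φ` becomes `r((1 + r)φ - D u)`.
    have h3 : k ^ 2 = -(r ^ 2 + r) := by linarith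
    simp only [map_add, map_sub, map_neg, S.div_v, S.div_grad, h3]
    module
  have hconst := is_const_of_deriv_eq_zero (fun t => (hd t).differentiableAt)
    (fun t => (hd t).deriv) t 0
  simp only [mul_zero, neg_zero, Real.exp_zero, one_smul] at hconst
  rw [← hconst, smul_smul, ← Real.exp_add]
  simp

end ModeSystem

end Lyapunov

/-! ### The matrix symbol -/

/-- The components of a state: `φ`, the three components of `u`, and those of `v`. -/
abbrev Idx : Type := Unit ⊕ (Fin 3 ⊕ Fin 3)

/-- The index of the component `φ`. -/
abbrev iφ : Idx := Sum.inl ()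

/-- The index of the `j`-th component of `u`. -/
abbrev iu (j : Fin 3) : Idx := Sum.inr (Sum.inl j)

/-- The index of the `j`-th component of `v`. -/
abbrev iv (j : Fin 3) : Idx := Sum.inr (Sum.inr j)

/-- The matrix symbol of the linear system. -/
noncomputable def symbol (c : ℝ) (ξ : R3) : Idx → Idx → ℂ
  | .inl _, .inr (.inl k) => -(2 * Real.pi * Complex.I * (ξ k : ℂ))
  | .inr (.inl j), .inl _ => -(2 * Real.pi * Complex.I * (ξ j : ℂ))
  | .inr (.inl j), .inr (.inl k) => if j = k then -1 else 0
  | .inr (.inl j), .inr (.inr k) => if j = k then 1 else 0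
  | .inr (.inr j), .inr (.inl k) => (c : ℂ) * ((if j = k then 1 else 0) + rieszSymbol j k ξ)
  | .inr (.inr j), .inr (.inr k) =>
    if j = k then -((c + (2 * Real.pi) ^ 2 * ‖ξ‖ ^ 2 : ℝ) : ℂ) else 0
  | _, _ => 0

theorem sum_symbol_φ (c : ℝ) (ξ : R3) (y : Idx → ℂ) :
    ∑ i, symbol c ξ iφ i * y i = -∑ j, 2 * Real.pi * Complex.I * (ξ j : ℂ) * y (iu j) := by
  simp [symbol, Fintype.sum_sum_type, Finset.sum_neg_distrib]

theorem sum_symbol_u (c : ℝ) (ξ : R3) (y : Idx → ℂ) (j : Fin 3) :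
    ∑ i, symbol c ξ (iu j) i * y i =
      -(2 * Real.pi * Complex.I * (ξ j : ℂ) * y iφ) - y (iu j) + y (iv j) := by
  simp [symbol, Fintype.sum_sum_type]
  ring

theorem sum_symbol_v (c : ℝ) (ξ : R3) (y : Idx → ℂ) (j : Fin 3) :
    ∑ i, symbol c ξ (iv j) i * y i =
      -((c + (2 * Real.pi) ^ 2 * ‖ξ‖ ^ 2 : ℝ) : ℂ) * y (iv j) +
        (c : ℂ) * (y (iu j) + ∑ k, rieszSymbol j k ξ * y (iu k)) := by
  simp [symbol, Fintype.sum_sum_type, mul_add, add_mul, Finset.sum_add_distrib, Finset.mul_sum,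
    mul_assoc]
  ring

theorem measurable_symbol (c : ℝ) : Measurable (symbol c) := by
  refine measurable_pi_iff.2 fun i => measurable_pi_iff.2 fun j => ?_
  rcases i with i | i | i <;> rcases j with j | j | j <;> simp only [symbol] <;>
    try split_ifs
  all_goals
    have := measurable_rieszSymbol
    fun_prop

/-- Quadratic growth is what the Bessel weight of order `s ≥ 2` can absorb, both for existence and
for uniqueness. -/
theorem norm_symbol_le (c : ℝ) (ξ : R3) (i j : Idx) :
    ‖symbol c ξ i j‖ ≤ (1 + 2 * |c| + (2 * Real.pi) ^ 2) * (1 + ‖ξ‖ ^ 2) := by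
  have hpi : 1 ≤ 2 * Real.pi := by linarith [Real.pi_gt_three]
  have hξ := norm_nonneg ξ
  have hc := abs_nonneg c
  have hA : (1 : ℝ) ≤ (2 * Real.pi) ^ 2 := one_le_pow₀ hpi
  set A := (2 * Real.pi) ^ 2 with hA'
  have hbig : 1 + 2 * |c| + A * (1 + ‖ξ‖ ^ 2) ≤ (1 + 2 * |c| + A) * (1 + ‖ξ‖ ^ 2) := by
    nlinarith [mul_nonneg hc (sq_nonneg ‖ξ‖), sq_nonneg ‖ξ‖]
  have h0 : 0 ≤ A * (1 + ‖ξ‖ ^ 2) := by positivity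
  have hone : 1 + 2 * |c| ≤ (1 + 2 * |c| + A) * (1 + ‖ξ‖ ^ 2) := by linarith
  have hfirst : ∀ k : Fin 3, ‖-(2 * Real.pi * Complex.I * (ξ k : ℂ))‖ ≤
      (1 + 2 * |c| + A) * (1 + ‖ξ‖ ^ 2) := by
    intro k
    have hk : |ξ k| ≤ ‖ξ‖ := by simpa using PiLp.norm_apply_le ξ k
    have h1 : ‖-(2 * Real.pi * Complex.I * (ξ k : ℂ))‖ = 2 * Real.pi * |ξ k| := by
      simp [abs_of_pos Real.pi_pos]
    rw [h1]
    calc 2 * Real.pi * |ξ k| ≤ A * (1 + ‖ξ‖ ^ 2) := by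
          refine mul_le_mul ?_ ?_ (abs_nonneg _) (by positivity)
          · rw [hA', sq]; nlinarith
          · nlinarith [sq_nonneg (‖ξ‖ - 1)]
      _ ≤ _ := by linarith
  rcases i with i | i | i <;> rcases j with j | j | j <;> simp only [symbol]
  any_goals exact hfirst _
  any_goals
    rw [norm_zero]
    positivity
  · split_ifs <;> simp only [norm_neg, norm_one, norm_zero] <;> linarith
  · split_ifs <;> simp only [norm_one, norm_zero] <;> linarith
  · have h1 : ‖(if i = j then 1 else 0 : ℂ) + rieszSymbol i j ξ‖ ≤ 2 := by
      refine (norm_add_le _ _).trans ?_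
      have h2 : ‖(if i = j then 1 else 0 : ℂ)‖ ≤ 1 := by split_ifs <;> simp
      linarith [norm_rieszSymbol_le i j ξ]
    rw [norm_mul, Complex.norm_real, Real.norm_eq_abs]
    nlinarith
  · split_ifs
    · rw [norm_neg, Complex.norm_real, Real.norm_eq_abs]
      refine (abs_add_le _ _).trans ?_
      rw [abs_of_nonneg (by positivity : 0 ≤ A * ‖ξ‖ ^ 2)]
      linarith
    · rw [norm_zero]
      positivity

/-! ### Gradient, divergence and projection at a fixed frequency -/

/-- Multiplication by the symbol of the gradient. -/
noncomputable def gradOp (ξ : R3) : ℂ →L[ℝ] EuclideanSpace ℂ (Fin 3) :=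
  LinearMap.toContinuousLinearMap
    { toFun := fun z => WithLp.toLp 2 fun j => 2 * Real.pi * Complex.I * (ξ j : ℂ) * z
      map_add' := fun z w => by ext j; simp; ring
      map_smul' := fun a z => by ext j; simp; ring }

/-- Multiplication by the symbol of the divergence. -/
noncomputable def divOp (ξ : R3) : EuclideanSpace ℂ (Fin 3) →L[ℝ] ℂ :=
  LinearMap.toContinuousLinearMap
    { toFun := fun w => ∑ j, 2 * Real.pi * Complex.I * (ξ j : ℂ) * w j
      map_add' := fun z w => by simp [mul_add, Finset.sum_add_distrib]
      map_smul' := fun a z => by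
        simp only [PiLp.smul_apply, Complex.real_smul, Finset.mul_sum, RingHom.id_apply]
        exact Finset.sum_congr rfl fun j _ => by ring }

@[simp]
theorem gradOp_apply (ξ : R3) (z : ℂ) (j : Fin 3) :
    gradOp ξ z j = 2 * Real.pi * Complex.I * (ξ j : ℂ) * z := rfl

@[simp]
theorem divOp_apply (ξ : R3) (w : EuclideanSpace ℂ (Fin 3)) :
    divOp ξ w = ∑ j, 2 * Real.pi * Complex.I * (ξ j : ℂ) * w j := rfl

theorem inner_gradOp (ξ : R3) (z : ℂ) (w : EuclideanSpace ℂ (Fin 3)) :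
    inner ℝ (gradOp ξ z) w = -inner ℝ z (divOp ξ w) := by
  simp only [PiLp.inner_apply, Fin.sum_univ_three, divOp_apply, gradOp_apply, Complex.inner]
  simp
  ring

theorem norm_gradOp (ξ : R3) (z : ℂ) : ‖gradOp ξ z‖ = 2 * Real.pi * ‖ξ‖ * ‖z‖ := by
  have h : ‖gradOp ξ z‖ ^ 2 = (2 * Real.pi * ‖ξ‖ * ‖z‖) ^ 2 := by
    rw [EuclideanSpace.norm_sq_eq, mul_pow, mul_pow, EuclideanSpace.norm_sq_eq]
    simp [Fin.sum_univ_three, mul_pow]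
    ring
  exact (sq_eq_sq₀ (norm_nonneg _) (by positivity)).1 h

/-- The velocity `u` of a Fourier mode. -/
noncomputable def uPart : (Idx → ℂ) →L[ℝ] EuclideanSpace ℂ (Fin 3) :=
  LinearMap.toContinuousLinearMap
    { toFun := fun y => WithLp.toLp 2 fun j => y (iu j)
      map_add' := fun z w => by ext j; simp
      map_smul' := fun a z => by ext j; simp }

/-- The velocity `v` of a Fourier mode. -/
noncomputable def vPart : (Idx → ℂ) →L[ℝ] EuclideanSpace ℂ (Fin 3) :=
  LinearMap.toContinuousLinearMap
    { toFun := fun y => WithLp.toLp 2 fun j => y (iv j)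
      map_add' := fun z w => by ext j; simp
      map_smul' := fun a z => by ext j; simp }

@[simp]
theorem uPart_apply (y : Idx → ℂ) (j : Fin 3) : uPart y j = y (iu j) := rfl

@[simp]
theorem vPart_apply (y : Idx → ℂ) (j : Fin 3) : vPart y j = y (iv j) := rfl

theorem sum_norm_sq_eq (y : Idx → ℂ) :
    ∑ i, ‖y i‖ ^ 2 = ‖y iφ‖ ^ 2 + ‖uPart y‖ ^ 2 + ‖vPart y‖ ^ 2 := by
  simp [EuclideanSpace.norm_sq_eq, Fintype.sum_sum_type, add_assoc]

/-- The symbol of the projection `𝒥`, applied to a vector. -/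
noncomputable def projOp (ξ : R3) (w : EuclideanSpace ℂ (Fin 3)) : EuclideanSpace ℂ (Fin 3) :=
  WithLp.toLp 2 fun j => w j + ∑ k, rieszSymbol j k ξ * w k

/-- The projection differs from the identity by a gradient, which is orthogonal to divergence-free
vectors. At `ξ = 0` the correction vanishes on both sides by the convention for division by zero. -/
theorem projOp_eq (ξ : R3) (w : EuclideanSpace ℂ (Fin 3)) :
    projOp ξ w = w + gradOp ξ ((((2 * Real.pi * ‖ξ‖) ^ 2)⁻¹ : ℝ) * divOp ξ w) := by
  ext j
  have hpi : (Real.pi : ℂ) ≠ 0 := by exact_mod_cast Real.pi_ne_zero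
  simp only [projOp, rieszSymbol, PiLp.add_apply, gradOp_apply, divOp_apply, Finset.mul_sum]
  congr 1
  refine Finset.sum_congr rfl fun k _ => ?_
  by_cases hξ : (‖ξ‖ : ℂ) = 0
  · simp [hξ]
  push_cast
  field_simp
  rw [Complex.I_sq]
  ring

theorem inner_projOp (ξ : R3) {v w : EuclideanSpace ℂ (Fin 3)} (hv : divOp ξ v = 0) :
    inner ℝ v (projOp ξ w) = inner ℝ v w := by
  rw [projOp_eq, inner_add_right, real_inner_comm (gradOp ξ _) v, inner_gradOp, hv]
  simp

theorem divOp_gradOp (ξ : R3) (z : ℂ) :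
    divOp ξ (gradOp ξ z) = -((((2 * Real.pi * ‖ξ‖) ^ 2 : ℝ) : ℂ) * z) := by
  have h : ((‖ξ‖ ^ 2 : ℝ) : ℂ) = (ξ 0 : ℂ) ^ 2 + (ξ 1 : ℂ) ^ 2 + (ξ 2 : ℂ) ^ 2 := by
    rw [EuclideanSpace.real_norm_sq_eq]
    simp [Fin.sum_univ_three]
  rw [mul_pow, Complex.ofReal_mul, h]
  simp only [divOp_apply, gradOp_apply, Fin.sum_univ_three]
  push_cast
  ring_nf
  rw [Complex.I_sq]
  ring

theorem divOp_projOp (ξ : R3) (w : EuclideanSpace ℂ (Fin 3)) : divOp ξ (projOp ξ w) = 0 := by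
  by_cases hξ : ξ = 0
  · simp [hξ]
  rw [projOp_eq, map_add, divOp_gradOp, ← mul_assoc, ← Complex.ofReal_mul, mul_inv_cancel₀]
  · simp
  · have := norm_pos_iff.2 hξ
    positivity

/-- The evolution of a single Fourier mode. -/
theorem modeSystem (c : ℝ) (ξ : R3) (y : Idx → ℂ) (hy : divOp ξ (vPart y) = 0) :
    ModeSystem c (2 * Real.pi * ‖ξ‖) (gradOp ξ) (divOp ξ) (fun t => flow (symbol c ξ) t y iφ)
      (fun t => uPart (flow (symbol c ξ) t y)) (fun t => vPart (flow (symbol c ξ) t y))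
      (fun t => projOp ξ (uPart (flow (symbol c ξ) t y))) := by
  have hv : ∀ t, HasDerivAt (fun t => vPart (flow (symbol c ξ) t y))
      (-(c + (2 * Real.pi * ‖ξ‖) ^ 2) • vPart (flow (symbol c ξ) t y) +
        c • projOp ξ (uPart (flow (symbol c ξ) t y))) t := by
    intro t
    refine (vPart.hasFDerivAt.comp_hasDerivAt t (hasDerivAt_flow (symbol c ξ) y t)).congr_deriv ?_
    ext j
    simp only [vPart_apply, toOp_apply, sum_symbol_v]
    simp [projOp]
    ring
  -- The projected field is divergence free, so `div v` solves a scalar homogeneous linear ODE with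
  -- zero initial value.
  have hdiv : ∀ t, divOp ξ (vPart (flow (symbol c ξ) t y)) = 0 := by
    intro t
    set a := c + (2 * Real.pi * ‖ξ‖) ^ 2
    have hd : ∀ t, HasDerivAt
        (fun t => Real.exp (a * t) • divOp ξ (vPart (flow (symbol c ξ) t y))) 0 t := by
      intro t
      have h1 := (divOp ξ).hasFDerivAt.comp_hasDerivAt t (hv t)
      have h2 : HasDerivAt (fun t => Real.exp (a * t)) (Real.exp (a * t) * (a * 1)) t :=
        ((hasDerivAt_id t).const_mul a).exp
      refine (h2.smul h1).congr_deriv ?_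
      rw [map_add, map_smul, map_smul, divOp_projOp, Function.comp_apply]
      module
    have hconst := is_const_of_deriv_eq_zero (fun t => (hd t).differentiableAt)
      (fun t => (hd t).deriv) t 0
    rw [flow_zero, hy, smul_zero] at hconst
    exact (smul_eq_zero.1 hconst).resolve_left (Real.exp_pos _).ne'
  refine ⟨inner_gradOp ξ, norm_gradOp ξ, fun t => ?_, fun t => ?_, hv, hdiv,
    fun t => inner_projOp ξ (hdiv t)⟩
  · refine (hasDerivAt_flow_apply (symbol c ξ) y t iφ).congr_deriv ?_
    rw [sum_symbol_φ]
    rfl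
  · refine (uPart.hasFDerivAt.comp_hasDerivAt t (hasDerivAt_flow (symbol c ξ) y t)).congr_deriv ?_
    ext j
    simp only [uPart_apply, toOp_apply, sum_symbol_u]
    rfl

/-! ### The Cauchy problem in frequency variables -/

/-- The components of a state as a family. -/
def State.comp (U : State) : Idx → L2
  | .inl _ => U.φ
  | .inr (.inl j) => U.u j
  | .inr (.inr j) => U.v j

/-- The state with the given components. -/
noncomputable def State.ofComp (f : Idx → L2) : State :=
  ⟨f iφ, WithLp.toLp 2 fun j => f (iu j), WithLp.toLp 2 fun j => f (iv j)⟩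

@[simp]
theorem State.comp_ofComp (f : Idx → L2) : (State.ofComp f).comp = f := by
  ext1 i
  rcases i with i | i | i <;> rfl

theorem State.comp_injective : Function.Injective State.comp := by
  rintro ⟨φ, u, v⟩ ⟨φ', u', v'⟩ h
  have h1 : φ = φ' := congrFun h iφ
  have h2 : u = u' := by
    ext1 j
    exact congrFun h (iu j)
  have h3 : v = v' := by
    ext1 j
    exact congrFun h (iv j)
  rw [h1, h2, h3]

/-- The Fourier modes of a state. -/
noncomputable def State.modes (U : State) (ξ : R3) (i : Idx) : ℂ := (𝓕 (U.comp i) : L2) ξ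

theorem State.measurable_modes (U : State) : Measurable U.modes :=
  measurable_pi_iff.2 fun _ => (Lp.stronglyMeasurable _).measurable

/-- The Fourier transform is a bijection of the Schwartz space, so testing in `x` and testing in `ξ`
are equivalent. -/
theorem hasTimeDeriv_iff {f : ℝ → L2} {F : ℝ → 𝓢'(R3, ℂ)} {m : ℝ → R3 → ℂ}
    (hF : ∀ t, FreqRep (F t) (m t)) :
    HasTimeDeriv f F ↔ ∀ t, 0 ≤ t → ∀ h : 𝓢(R3, ℂ),
      HasDerivWithinAt (fun τ => ∫ ξ, h ξ * (𝓕 (f τ) : L2) ξ) (∫ ξ, h ξ * m t ξ) (Ici 0) t := by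
  have h1 : ∀ τ (g : 𝓢(R3, ℂ)), (f τ : 𝓢'(R3, ℂ)) g = ∫ ξ, (𝓕⁻ g) ξ * (𝓕 (f τ) : L2) ξ :=
    fun τ g => (freqRep_lp (f τ) g).2
  constructor
  · intro H t ht h
    have h2 := H t ht (𝓕 h)
    simpa only [h1, (hF t _).2, fourierInv_fourier_eq] using h2
  · intro H t ht g
    simpa only [h1, (hF t _).2] using H t ht (𝓕⁻ g)

/-- The Cauchy problem on the Fourier side. -/
theorem isGlobalSolution_iff {c : ℝ} {s : ℕ} {U₀ : State} {U : ℝ → State} :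
    IsGlobalSolution c s U₀ U ↔ (∀ i, ContinuousInH s fun t => (U t).comp i) ∧ U 0 = U₀ ∧
      ∀ i t, 0 ≤ t → ∀ h : 𝓢(R3, ℂ),
        HasDerivWithinAt (fun τ => ∫ ξ, h ξ * (U τ).modes ξ i)
          (∫ ξ, h ξ * ∑ j, symbol c ξ i j * (U t).modes ξ j) (Ici 0) t := by
  have hφ : HasTimeDeriv (fun t => (U t).φ) (fun t => -div (U t).u) ↔ _ :=
    hasTimeDeriv_iff (m := fun t ξ => ∑ j, symbol c ξ iφ j * (U t).modes ξ j) fun t => by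
      simp only [sum_symbol_φ]
      exact (FreqRep.sum _ fun j => (freqRep_lp ((U t).u j)).lineDeriv j).neg
  have hu : ∀ j, HasTimeDeriv (fun t => (U t).u j) (fun t =>
      -(∂_{e j} ((U t).φ : 𝓢'(R3, ℂ)) + ((U t).u j : 𝓢'(R3, ℂ)) - ((U t).v j : 𝓢'(R3, ℂ)))) ↔ _ :=
    fun j => hasTimeDeriv_iff (m := fun t ξ => ∑ i, symbol c ξ (iu j) i * (U t).modes ξ i)
      fun t => by
        convert ((((freqRep_lp (U t).φ).lineDeriv j).add (freqRep_lp ((U t).u j))).sub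
          (freqRep_lp ((U t).v j))).neg using 2 with ξ
        rw [sum_symbol_u]
        simp only [State.modes, State.comp]
        ring
  have hv : ∀ j, HasTimeDeriv (fun t => (U t).v j) (fun t =>
      -((c : ℂ) • ((U t).v j : 𝓢'(R3, ℂ)) - (c : ℂ) • (projJ (U t).u j : 𝓢'(R3, ℂ))
      - Δ ((U t).v j : 𝓢'(R3, ℂ)))) ↔ _ :=
    fun j => hasTimeDeriv_iff (m := fun t ξ => ∑ i, symbol c ξ (iv j) i * (U t).modes ξ i)
      fun t => by
        convert ((((freqRep_lp ((U t).v j)).smul c).sub ((freqRep_projJ (U t).u j).smul c)).sub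
          (freqRep_lp ((U t).v j)).laplacian).neg using 2 with ξ
        rw [sum_symbol_v]
        simp only [State.modes, State.comp]
        push_cast
        ring
  constructor
  · intro H
    refine ⟨?_, H.initial, ?_⟩
    · rintro (i | i | i)
      exacts [H.cont_φ, H.cont_u i, H.cont_v i]
    · rintro (i | i | i)
      exacts [hφ.1 H.eq_φ, (hu i).1 (H.eq_u i), (hv i).1 (H.eq_v i)]
  · rintro ⟨h1, h2, h3⟩
    exact ⟨h1 iφ, fun j => h1 (iu j), fun j => h1 (iv j), h2, hφ.2 (h3 iφ),
      fun j => (hu j).2 (h3 (iu j)), fun j => (hv j).2 (h3 (iv j))⟩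

/-! ### Mode decay and existence -/

/-- Decay of the Fourier modes. -/
theorem exists_mode_decay {c : ℝ} (hc : 0 < c) : ∃ K a : ℝ, 0 < K ∧ 0 < a ∧
    ∀ (ξ : R3) (y : Idx → ℂ), divOp ξ (vPart y) = 0 → ∀ t, 0 ≤ t →
      ∑ i, ‖flow (symbol c ξ) t y i‖ ^ 2 ≤ K * Real.exp (-(a *
        ((2 * Real.pi * ‖ξ‖) ^ 2 / (1 + (2 * Real.pi * ‖ξ‖) ^ 2)) * t)) * ∑ i, ‖y i‖ ^ 2 := by
  set δ := min c 1 / 2 with hδ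
  have hm : 0 < min c 1 := lt_min hc one_pos
  have hδ0 : 0 < δ := by positivity
  have h1 : 2 * δ ≤ c := by linarith [min_le_left c 1]
  have h2 : δ ≤ 1 := by linarith [min_le_right c 1]
  refine ⟨(3 * c + 1) / δ, δ / (3 * c + 1), by positivity, by positivity, fun ξ y hy t ht => ?_⟩
  have h := (modeSystem c ξ y hy).norm_sq_le hc (by positivity) hδ0 h1 h2 ht
  simpa only [sum_norm_sq_eq, flow_zero] using h

theorem State.divOp_modes_eq_zero {U : State} (hU : div U.v = 0) :
    ∀ᵐ ξ : R3, divOp ξ (vPart (U.modes ξ)) = 0 := by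
  filter_upwards [sum_mul_fourier_eq_zero_of_div_eq_zero U.v hU] with ξ hξ
  simp only [divOp_apply, mul_assoc, ← Finset.mul_sum]
  have h : ∑ j, (ξ j : ℂ) * vPart (U.modes ξ) j = 0 := hξ
  rw [h]
  simp

theorem State.MemH.comp {s : ℕ} {U : State} (hU : U.MemH s) (i : Idx) :
    ENS.MemH s (U.comp i) := by
  rcases i with i | i | i
  exacts [hU.1, hU.2.1 i, hU.2.2 i]

theorem State.MemH.integrable_bessel {s : ℕ} {U : State} (hU : U.MemH s) :
    Integrable fun ξ => bessel s ξ ^ 2 * ∑ i, ‖U.modes ξ i‖ ^ 2 := by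
  simp only [Finset.mul_sum]
  refine integrable_finsetSum _ fun i _ => ?_
  obtain ⟨w, hw⟩ := hU.comp i
  refine (L2.integrable_norm_sq (𝓕 w : L2)).congr ?_
  filter_upwards [(besselPotential_eq_iff s _ w).1 hw] with ξ hξ
  rw [hξ, norm_mul, mul_pow, Complex.norm_real, Real.norm_of_nonneg (bessel_pos s ξ).le]
  rfl

theorem one_le_bessel (s : ℕ) (ξ : R3) : 1 ≤ bessel s ξ :=
  Real.one_le_rpow (by nlinarith [sq_nonneg ‖ξ‖]) (by positivity)

theorem aestronglyMeasurable_flow (c t : ℝ) (U : State) (i : Idx) :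
    AEStronglyMeasurable (fun ξ => flow (symbol c ξ) t (U.modes ξ) i) (volume : Measure R3) :=
  (((measurable_pi_apply i).comp ((continuous_flow t).measurable.comp
    ((measurable_symbol c).prodMk U.measurable_modes)))).aestronglyMeasurable

/-- Existence, together with the Fourier representation of the solution. -/
theorem exists_solution {c : ℝ} (hc : 0 < c) {s : ℕ} (hs : 2 ≤ s) {U₀ : State}
    (hH : U₀.MemH s) (hdiv : div U₀.v = 0) :
    ∃ U : ℝ → State, IsGlobalSolution c s U₀ U ∧ ∀ t, 0 ≤ t → ∀ i,
      (fun ξ => (U t).modes ξ i) =ᵐ[volume] fun ξ => flow (symbol c ξ) t (U₀.modes ξ) i := by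
  obtain ⟨K, a, hK, ha, hdecay⟩ := exists_mode_decay hc
  set Y : ℝ → R3 → Idx → ℂ := fun t ξ => flow (symbol c ξ) t (U₀.modes ξ) with hY
  -- A majorant of the modes that is independent of time, obtained by dropping the decaying
  -- exponential.
  set B : R3 → ℝ := fun ξ => Real.sqrt (K * ∑ i, ‖U₀.modes ξ i‖ ^ 2) with hB
  have hB0 : ∀ ξ, 0 ≤ B ξ := fun ξ => Real.sqrt_nonneg _
  have hBm : AEStronglyMeasurable B volume := by
    have := U₀.measurable_modes
    refine Measurable.aestronglyMeasurable ?_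
    simp only [hB]
    fun_prop
  have hBsq : ∀ ξ, B ξ ^ 2 = K * ∑ i, ‖U₀.modes ξ i‖ ^ 2 := fun ξ =>
    Real.sq_sqrt (by positivity)
  have hYB : ∀ᵐ ξ, ∀ t, 0 ≤ t → ∀ i, ‖Y t ξ i‖ ≤ B ξ := by
    filter_upwards [State.divOp_modes_eq_zero hdiv] with ξ hξ t ht i
    refine Real.le_sqrt_of_sq_le ?_
    calc ‖Y t ξ i‖ ^ 2 ≤ ∑ i, ‖Y t ξ i‖ ^ 2 :=
          Finset.single_le_sum (f := fun i => ‖Y t ξ i‖ ^ 2) (fun i _ => by positivity)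
            (Finset.mem_univ i)
      _ ≤ _ := hdecay ξ _ hξ t ht
      _ ≤ K * 1 * ∑ i, ‖U₀.modes ξ i‖ ^ 2 := by
          gcongr
          exact Real.exp_le_one_iff.2 (neg_nonpos.2 (by positivity))
      _ = _ := by ring
  have hbB : Integrable fun ξ => (bessel s ξ * B ξ) ^ 2 := by
    refine (hH.integrable_bessel.const_mul K).congr (Eventually.of_forall fun ξ => ?_)
    simp only [mul_pow, hBsq]
    ring
  have hbm : AEStronglyMeasurable (bessel s) (volume : Measure R3) :=
    (continuous_bessel s).aestronglyMeasurable
  have hbBm : MemLp (fun ξ => bessel s ξ * B ξ) 2 (volume : Measure R3) :=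
    (memLp_two_iff_integrable_sq (hbm.mul hBm)).2 hbB
  have hbY : ∀ t, 0 ≤ t → ∀ i, MemLp (fun ξ => (bessel s ξ : ℂ) * Y t ξ i) 2 volume := by
    intro t ht i
    refine hbBm.of_le ((Complex.continuous_ofReal.comp_aestronglyMeasurable hbm).mul
      (aestronglyMeasurable_flow c t U₀ i)) ?_
    filter_upwards [hYB] with ξ hξ
    rw [norm_mul, Complex.norm_real, norm_mul, Real.norm_of_nonneg (hB0 ξ)]
    gcongr
    exact hξ t ht i
  have hYm : ∀ t, 0 ≤ t → ∀ i, MemLp (fun ξ => Y t ξ i) 2 volume := by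
    intro t ht i
    refine (hbY t ht i).of_le (aestronglyMeasurable_flow c t U₀ i)
      (Eventually.of_forall fun ξ => ?_)
    rw [norm_mul, Complex.norm_real, Real.norm_of_nonneg (bessel_pos s ξ).le]
    exact le_mul_of_one_le_left (norm_nonneg _) (one_le_bessel s ξ)
  -- The mode bound holds only for `t ≥ 0`; `max t 0` gives a harmless value at negative times.
  set U : ℝ → State := fun t => State.ofComp fun i =>
    𝓕⁻ ((hYm (max t 0) (le_max_right _ _) i).toLp _) with hU
  have hUY : ∀ t, 0 ≤ t → ∀ i, (fun ξ => (U t).modes ξ i) =ᵐ[volume] fun ξ => Y t ξ i := by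
    intro t ht i
    simp only [hU, State.modes, State.comp_ofComp, fourier_fourierInv_eq]
    refine (MemLp.coeFn_toLp _).trans ?_
    rw [max_eq_left ht]
  refine ⟨U, isGlobalSolution_iff.2 ⟨fun i => ?_, ?_, fun i t ht h => ?_⟩, hUY⟩
  · set w : ℝ → L2 := fun t => (hbY (max t 0) (le_max_right _ _) i).toLp _ with hw
    have hwY : ∀ t, 0 ≤ t → (w t : R3 → ℂ) =ᵐ[volume] fun ξ => (bessel s ξ : ℂ) * Y t ξ i := by
      intro t ht
      refine (MemLp.coeFn_toLp _).trans ?_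
      rw [max_eq_left ht]
    have hwc : ContinuousOn w (Ici 0) := by
      refine continuousOn_L2_of_dominated hwY hbB ?_ ?_
      · filter_upwards [hYB] with ξ hξ t ht
        rw [norm_mul, Complex.norm_real, Real.norm_of_nonneg (bessel_pos s ξ).le]
        exact mul_le_mul_of_nonneg_left (hξ t ht i) (bessel_pos s ξ).le
      · refine Eventually.of_forall fun ξ => ContinuousOn.mul continuousOn_const fun t _ => ?_
        exact (hasDerivAt_flow_apply _ _ t i).continuousAt.continuousWithinAt
    refine ⟨fun t => 𝓕⁻ (w t), ?_, fun t ht => ?_⟩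
    · exact (Lp.fourierTransformₗᵢ R3 ℂ).symm.continuous.comp_continuousOn hwc
    · rw [besselPotential_eq_iff, fourier_fourierInv_eq]
      filter_upwards [hwY t ht, hUY t ht i] with ξ h1 h2
      rw [h1, ← h2]
      rfl
  · refine State.comp_injective (funext fun i => ?_)
    refine (Lp.fourierTransformₗᵢ R3 ℂ).injective ?_
    refine Lp.ext ((hUY 0 le_rfl i).trans ?_)
    simp only [hY, flow_zero]
    rfl
  · have hint : ∀ τ, 0 ≤ τ → ∫ ξ, h ξ * (U τ).modes ξ i = ∫ ξ, h ξ * Y τ ξ i := by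
      intro τ hτ
      refine integral_congr_ae ?_
      filter_upwards [hUY τ hτ i] with ξ hξ
      rw [hξ]
    have hint' : ∫ ξ, h ξ * ∑ j, symbol c ξ i j * (U t).modes ξ j =
        ∫ ξ, h ξ * ∑ j, symbol c ξ i j * Y t ξ j := by
      refine integral_congr_ae ?_
      filter_upwards [ae_all_iff.2 (hUY t ht)] with ξ hξ
      simp only [hξ]
    rw [hint']
    refine HasDerivWithinAt.congr (f := fun τ => ∫ ξ, h ξ * Y τ ξ i) ?_ (fun τ hτ => hint τ hτ)
      (hint t ht)
    set M := 1 + 2 * |c| + (2 * Real.pi) ^ 2 with hM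
    -- The factor `7` counts the components of a state; `bessel s` pays for the quadratic growth of
    -- the symbol.
    refine hasDerivWithinAt_integral_Ici (F := fun τ ξ => h ξ * Y τ ξ i)
      (F' := fun τ ξ => h ξ * ∑ j, symbol c ξ i j * Y τ ξ j)
      (B := fun ξ => ‖h ξ‖ * (7 * M * (bessel s ξ * B ξ))) ?_ ?_ ?_ ?_ ht
    · intro τ hτ
      exact (h.memLp 2 volume).integrable_mul (hYm τ hτ i)
    · exact (h.memLp 2 volume).norm.integrable_mul (hbBm.const_mul (7 * M))
    · refine Eventually.of_forall fun ξ τ _ => ?_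
      exact ((hasDerivAt_flow_apply _ _ τ i).const_mul (h ξ)).hasDerivWithinAt
    · filter_upwards [hYB] with ξ hξ τ hτ
      rw [norm_mul]
      gcongr
      refine (norm_sum_le _ _).trans ?_
      calc ∑ j, ‖symbol c ξ i j * Y τ ξ j‖ ≤ ∑ _j : Idx, M * bessel s ξ * B ξ := by
            refine Finset.sum_le_sum fun j _ => ?_
            rw [norm_mul]
            refine mul_le_mul ((norm_symbol_le c ξ i j).trans ?_) (hξ τ hτ j) (norm_nonneg _) ?_
            · gcongr
              exact one_add_norm_sq_le_bessel hs ξ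
            · have := bessel_pos s ξ
              positivity
        _ = _ := by
            simp
            ring

/-! ### Uniqueness -/

theorem memLp_mul_of_bounded {a : R3 → ℂ} (ha : Measurable a) {K : ℝ} (hK : ∀ ξ, ‖a ξ‖ ≤ K)
    (f : L2) : MemLp (fun ξ => a ξ * f ξ) 2 (volume : Measure R3) :=
  (Lp.memLp f).of_le_mul (ha.aestronglyMeasurable.mul (Lp.aestronglyMeasurable f))
    (Eventually.of_forall fun ξ => by
      rw [norm_mul]
      exact mul_le_mul_of_nonneg_right (hK ξ) (norm_nonneg _))

/-- Multiplication by a bounded measurable function on `L²`. -/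
noncomputable def mulL2 (a : R3 → ℂ) (ha : Measurable a) (K : ℝ) (hK : ∀ ξ, ‖a ξ‖ ≤ K) :
    L2 →L[ℂ] L2 :=
  LinearMap.mkContinuous
    { toFun := fun f => (memLp_mul_of_bounded ha hK f).toLp _
      map_add' := fun f g => by
        rw [← MemLp.toLp_add]
        refine MemLp.toLp_congr _ _ ?_
        filter_upwards [Lp.coeFn_add f g] with ξ hξ
        rw [hξ, Pi.add_apply, Pi.add_apply]
        ring
      map_smul' := fun b f => by
        rw [RingHom.id_apply, ← MemLp.toLp_const_smul]
        refine MemLp.toLp_congr _ _ ?_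
        filter_upwards [Lp.coeFn_smul b f] with ξ hξ
        rw [hξ, Pi.smul_apply, Pi.smul_apply, smul_eq_mul, smul_eq_mul]
        ring }
    K fun f => by
      refine Lp.norm_le_mul_norm_of_ae_le_mul ?_
      filter_upwards [(memLp_mul_of_bounded ha hK f).coeFn_toLp] with ξ hξ
      change ‖(memLp_mul_of_bounded ha hK f).toLp _ ξ‖ ≤ _
      rw [hξ, norm_mul]
      exact mul_le_mul_of_nonneg_right (hK ξ) (norm_nonneg _)

theorem coeFn_mulL2 {a : R3 → ℂ} (ha : Measurable a) {K : ℝ} (hK : ∀ ξ, ‖a ξ‖ ≤ K) (f : L2) :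
    (mulL2 a ha K hK f : R3 → ℂ) =ᵐ[volume] fun ξ => a ξ * f ξ :=
  (memLp_mul_of_bounded ha hK f).coeFn_toLp

/-- Integration against a Schwartz function on `L²`. -/
noncomputable def pairL2 (h : 𝓢(R3, ℂ)) : L2 →L[ℂ] ℂ :=
  (ContinuousLinearMap.mul ℂ ℂ).lpPairing volume 2 2 (h.toLp 2)

theorem pairL2_apply (h : 𝓢(R3, ℂ)) (f : L2) : pairL2 h f = ∫ ξ, h ξ * f ξ := by
  rw [pairL2, ContinuousLinearMap.lpPairing_eq_integral]
  refine integral_congr_ae ?_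
  filter_upwards [h.coeFn_toLp 2 volume] with ξ hξ
  rw [hξ]
  rfl

theorem eq_zero_of_pairL2_eq_zero {f : L2} (hf : ∀ h, pairL2 h f = 0) : f = 0 := by
  have h1 : Lp.toTemperedDistributionCLM ℂ (volume : Measure R3) 2 f = 0 := by
    ext h
    simpa [pairL2_apply] using hf h
  exact LinearMap.ker_eq_bot'.1
    (Lp.ker_toTemperedDistributionCLM_eq_bot (F := ℂ) (μ := (volume : Measure R3)) (p := 2)) f h1

/-- A curve in `L²` with a continuous weak derivative is differentiable in norm. -/
theorem hasDerivWithinAt_of_weak {f G : ℝ → L2} (hG : ContinuousOn G (Ici 0))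
    (hf : ∀ h t, 0 ≤ t →
      HasDerivWithinAt (fun τ => pairL2 h (f τ)) (pairL2 h (G t)) (Ici 0) t)
    {t : ℝ} (ht : 0 ≤ t) : HasDerivWithinAt f (G t) (Ici 0) t := by
  -- Extending `G` by its value at `0` makes it continuous on the whole line, so its primitive is
  -- differentiable at `0` too.
  set G' : ℝ → L2 := fun t => G (max t 0) with hG'
  have hG'c : Continuous G' := hG.comp_continuous (by fun_prop) fun t => mem_Ici.2 (le_max_right _ _)
  -- The fundamental theorem of calculus holds after pairing with each Schwartz function; pairing
  -- commutes with the integral and separates points of `L²`.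
  have key : ∀ t, 0 ≤ t → f t = f 0 + ∫ τ in (0 : ℝ)..t, G' τ := by
    intro t ht
    rw [← sub_eq_zero]
    refine eq_zero_of_pairL2_eq_zero fun h => ?_
    have h1 : ∫ τ in (0 : ℝ)..t, pairL2 h (G' τ) = pairL2 h (f t) - pairL2 h (f 0) := by
      refine intervalIntegral.integral_eq_sub_of_hasDeriv_right_of_le (f := fun τ => pairL2 h (f τ))
        ht ?_ ?_ ?_
      · exact fun τ hτ => (hf h τ hτ.1).continuousWithinAt.mono Icc_subset_Ici_self
      · intro τ hτ
        have h2 : G' τ = G τ := by simp only [hG', max_eq_left hτ.1.le]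
        rw [h2]
        exact (hf h τ hτ.1.le).mono fun x hx => hτ.1.le.trans (mem_Ioi.1 hx).le
      · exact ((pairL2 h).continuous.comp hG'c).intervalIntegrable _ _
    rw [ContinuousLinearMap.intervalIntegral_comp_comm _ (hG'c.intervalIntegrable _ _)] at h1
    rw [map_sub, map_add, h1]
    ring
  have h2 : HasDerivAt (fun t => f 0 + ∫ τ in (0 : ℝ)..t, G' τ) (G' t) t :=
    ((hG'c.integral_hasStrictDerivAt 0 t).hasDerivAt).const_add (f 0)
  have h3 : G' t = G t := by simp only [hG', max_eq_left ht]
  rw [← h3]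
  exact h2.hasDerivWithinAt.congr (fun τ hτ => key τ hτ) (key t ht)

theorem measurable_symbol_apply (c : ℝ) (i j : Idx) : Measurable fun ξ => symbol c ξ i j :=
  (measurable_pi_apply j).comp ((measurable_pi_apply i).comp (measurable_symbol c))

/-- The Fourier transform of a solution is differentiable in `L²`. -/
theorem IsGlobalSolution.exists_hasDerivWithinAt {c : ℝ} {s : ℕ} (hs : 2 ≤ s) {U₀ : State}
    {U : ℝ → State} (hU : IsGlobalSolution c s U₀ U) (i : Idx) :
    ∃ G : ℝ → L2, ∀ t, 0 ≤ t → HasDerivWithinAt (fun τ => (𝓕 ((U τ).comp i) : L2)) (G t) (Ici 0) t ∧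
      (G t : R3 → ℂ) =ᵐ[volume] fun ξ => ∑ j, symbol c ξ i j * (U t).modes ξ j := by
  obtain ⟨hcont, -, heq⟩ := isGlobalSolution_iff.1 hU
  choose w hwc hw using hcont
  have hmeas : ∀ j, Measurable fun ξ => symbol c ξ i j / (bessel s ξ : ℂ) := fun j =>
    (measurable_symbol_apply c i j).div
      (Complex.measurable_ofReal.comp (continuous_bessel s).measurable)
  -- The symbol divided by the Bessel weight is bounded, so applied to the continuous curve `⟨D⟩^s
  -- U` it gives a right-hand side continuous in `L²`.
  have hbd : ∀ j ξ, ‖symbol c ξ i j / (bessel s ξ : ℂ)‖ ≤ 1 + 2 * |c| + (2 * Real.pi) ^ 2 := by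
    intro j ξ
    have hb := bessel_pos s ξ
    rw [norm_div, Complex.norm_real, Real.norm_of_nonneg hb.le, div_le_iff₀ hb]
    refine (norm_symbol_le c ξ i j).trans ?_
    gcongr
    exact one_add_norm_sq_le_bessel hs ξ
  set G : ℝ → L2 := fun t => ∑ j, mulL2 _ (hmeas j) _ (hbd j) (𝓕 (w j t)) with hG
  have hGae : ∀ t, 0 ≤ t →
      (G t : R3 → ℂ) =ᵐ[volume] fun ξ => ∑ j, symbol c ξ i j * (U t).modes ξ j := by
    intro t ht
    have h1 : ∀ᵐ ξ, ∀ j, (mulL2 _ (hmeas j) _ (hbd j) (𝓕 (w j t)) : L2) ξ =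
        symbol c ξ i j / (bessel s ξ : ℂ) * (𝓕 (w j t) : L2) ξ :=
      ae_all_iff.2 fun j => coeFn_mulL2 (hmeas j) (hbd j) _
    have h2 : ∀ᵐ ξ, ∀ j, (𝓕 (w j t) : L2) ξ = (bessel s ξ : ℂ) * (U t).modes ξ j :=
      ae_all_iff.2 fun j => (besselPotential_eq_iff s _ _).1 (hw j t ht)
    filter_upwards [h1, h2, Lp.coeFn_finsetSum Finset.univ
      fun j => (mulL2 _ (hmeas j) _ (hbd j) (𝓕 (w j t)) : L2)] with ξ h1 h2 h3
    rw [h3, Finset.sum_apply]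
    refine Finset.sum_congr rfl fun j _ => ?_
    have hb : (bessel s ξ : ℂ) ≠ 0 := by exact_mod_cast (bessel_pos s ξ).ne'
    rw [h1, h2]
    field_simp
  refine ⟨G, fun t ht => ⟨hasDerivWithinAt_of_weak ?_ (fun h t ht => ?_) ht, hGae t ht⟩⟩
  · refine continuousOn_finsetSum _ fun j _ => ?_
    exact ((mulL2 _ (hmeas j) _ (hbd j)).continuous.comp
      (Lp.fourierTransformₗᵢ R3 ℂ).continuous).comp_continuousOn (hwc j)
  · simp only [pairL2_apply]
    have h1 : ∫ ξ, h ξ * G t ξ = ∫ ξ, h ξ * ∑ j, symbol c ξ i j * (U t).modes ξ j := by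
      refine integral_congr_ae ?_
      filter_upwards [hGae t ht] with ξ hξ
      rw [hξ]
    rw [h1]
    exact heq i t ht h

/-- Uniqueness of the solution. -/
theorem IsGlobalSolution.unique {c : ℝ} {s : ℕ} (hs : 2 ≤ s) {U₀ : State} {U V : ℝ → State}
    (hU : IsGlobalSolution c s U₀ U) (hV : IsGlobalSolution c s U₀ V) {t : ℝ} (ht : 0 ≤ t) :
    V t = U t := by
  -- Restricting to a ball of frequencies commutes with the evolution and turns the generator into a
  -- bounded operator, to which Lipschitz ODE uniqueness applies.
  have hχm (R : ℕ) : Measurable ((Metric.closedBall (0 : R3) R).indicator (1 : R3 → ℂ)) :=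
    measurable_one.indicator Metric.isClosed_closedBall.measurableSet
  have hχb (R : ℕ) (ξ : R3) : ‖(Metric.closedBall (0 : R3) R).indicator (1 : R3 → ℂ) ξ‖ ≤ 1 := by
    rw [norm_indicator_eq_indicator_norm]
    exact indicator_le' (fun _ _ => by simp) (fun _ _ => zero_le_one) ξ
  have hAm (R : ℕ) (i j : Idx) : Measurable fun ξ =>
      (Metric.closedBall (0 : R3) R).indicator (1 : R3 → ℂ) ξ * symbol c ξ i j :=
    (hχm R).mul (measurable_symbol_apply c i j)
  have hAb (R : ℕ) (i j : Idx) (ξ : R3) :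
      ‖(Metric.closedBall (0 : R3) R).indicator (1 : R3 → ℂ) ξ * symbol c ξ i j‖ ≤
        (1 + 2 * |c| + (2 * Real.pi) ^ 2) * (1 + (R : ℝ) ^ 2) := by
    by_cases hξ : ξ ∈ Metric.closedBall (0 : R3) R
    · rw [indicator_of_mem hξ, Pi.one_apply, one_mul]
      refine (norm_symbol_le c ξ i j).trans ?_
      gcongr
      simpa using hξ
    · rw [indicator_of_notMem hξ, zero_mul, norm_zero]
      positivity
  set χ : ℕ → L2 →L[ℂ] L2 := fun R => mulL2 _ (hχm R) 1 (hχb R) with hχ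
  set A : ℕ → (Idx → L2) →L[ℂ] (Idx → L2) := fun R => ContinuousLinearMap.pi fun i =>
    ∑ j, (mulL2 _ (hAm R i j) _ (hAb R i j)).comp (ContinuousLinearMap.proj j) with hA
  have hode (R : ℕ) {W : ℝ → State} (hW : IsGlobalSolution c s U₀ W) : ∀ τ, 0 ≤ τ →
      HasDerivWithinAt (fun τ i => χ R (𝓕 ((W τ).comp i)))
        (A R fun i => χ R (𝓕 ((W τ).comp i))) (Ici 0) τ := by
    intro τ hτ
    rw [hasDerivWithinAt_pi]
    intro i
    obtain ⟨G, hG⟩ := hW.exists_hasDerivWithinAt hs i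
    obtain ⟨h1, h2⟩ := hG τ hτ
    have h3 := ((χ R).restrictScalars ℝ).hasFDerivAt.comp_hasDerivWithinAt τ h1
    refine h3.congr_deriv ?_
    refine Lp.ext ?_
    have h4 : (A R fun i => χ R (𝓕 ((W τ).comp i))) i =
        ∑ j, mulL2 _ (hAm R i j) _ (hAb R i j) (χ R (𝓕 ((W τ).comp j))) := by
      simp [hA]
    rw [h4]
    have h5 : ∀ᵐ ξ, ∀ j, (mulL2 _ (hAm R i j) _ (hAb R i j) (χ R (𝓕 ((W τ).comp j))) : L2) ξ =
        (Metric.closedBall (0 : R3) R).indicator (1 : R3 → ℂ) ξ * symbol c ξ i j *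
          (χ R (𝓕 ((W τ).comp j)) : L2) ξ :=
      ae_all_iff.2 fun j => coeFn_mulL2 (hAm R i j) (hAb R i j) _
    have h6 : ∀ᵐ ξ, ∀ j, (χ R (𝓕 ((W τ).comp j)) : L2) ξ =
        (Metric.closedBall (0 : R3) R).indicator (1 : R3 → ℂ) ξ * (W τ).modes ξ j :=
      ae_all_iff.2 fun j => coeFn_mulL2 (hχm R) (hχb R) _
    filter_upwards [h2, h5, h6, coeFn_mulL2 (hχm R) (hχb R) (G τ),
      Lp.coeFn_finsetSum Finset.univ fun j =>
        (mulL2 _ (hAm R i j) _ (hAb R i j) (χ R (𝓕 ((W τ).comp j))) : L2)] with ξ h2 h5 h6 h7 h8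
    rw [h8, Finset.sum_apply]
    change (χ R (G τ) : L2) ξ = _
    rw [h7, h2, Finset.mul_sum]
    refine Finset.sum_congr rfl fun j _ => ?_
    rw [h5, h6]
    by_cases hξ : ξ ∈ Metric.closedBall (0 : R3) R
    · rw [indicator_of_mem hξ, Pi.one_apply]
      ring
    · rw [indicator_of_notMem hξ]
      ring
  have heq (R : ℕ) (i : Idx) : χ R (𝓕 ((V t).comp i)) = χ R (𝓕 ((U t).comp i)) := by
    have h1 := ODE_solution_unique (v := fun _ => A R) (K := ‖A R‖₊) (a := 0) (b := t)
      (fun _ => (A R).lipschitz)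
      (fun τ hτ => (hode R hV τ hτ.1).continuousWithinAt.mono Icc_subset_Ici_self)
      (fun τ hτ => (hode R hV τ hτ.1).mono (Ici_subset_Ici.2 hτ.1))
      (fun τ hτ => (hode R hU τ hτ.1).continuousWithinAt.mono Icc_subset_Ici_self)
      (fun τ hτ => (hode R hU τ hτ.1).mono (Ici_subset_Ici.2 hτ.1))
      (by rw [hU.initial, hV.initial])
    exact congrFun (h1 (right_mem_Icc.2 ht)) i
  refine State.comp_injective (funext fun i => ?_)
  refine (Lp.fourierTransformₗᵢ R3 ℂ).injective (Lp.ext ?_)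
  have h1 : ∀ᵐ ξ, ∀ R : ℕ, (Metric.closedBall (0 : R3) R).indicator (1 : R3 → ℂ) ξ *
      (V t).modes ξ i = (Metric.closedBall (0 : R3) R).indicator (1 : R3 → ℂ) ξ *
        (U t).modes ξ i := by
    refine ae_all_iff.2 fun R => ?_
    have h2 := coeFn_mulL2 (hχm R) (hχb R) (𝓕 ((V t).comp i))
    have h3 := coeFn_mulL2 (hχm R) (hχb R) (𝓕 ((U t).comp i))
    have h4 : mulL2 _ (hχm R) 1 (hχb R) (𝓕 ((V t).comp i)) =
      mulL2 _ (hχm R) 1 (hχb R) (𝓕 ((U t).comp i)) := heq R i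
    rw [h4] at h2
    exact h2.symm.trans h3
  filter_upwards [h1] with ξ hξ
  obtain ⟨R, hR⟩ := exists_nat_ge ‖ξ‖
  have h2 := hξ R
  rw [indicator_of_mem (by simpa using hR), Pi.one_apply, one_mul, one_mul] at h2
  exact h2

/-! ### Upper decay bound -/

theorem State.sq_norms_eq_integral (U : State) :
    ‖U.φ‖ ^ 2 + ‖U.u‖ ^ 2 + ‖U.v‖ ^ 2 = ∫ ξ, ∑ i, ‖U.modes ξ i‖ ^ 2 := by
  rw [integral_finsetSum (f := fun i ξ => ‖U.modes ξ i‖ ^ 2) _ fun i _ =>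
    L2.integrable_norm_sq (𝓕 (U.comp i) : L2)]
  have h : ∀ i, ∫ ξ, ‖U.modes ξ i‖ ^ 2 = ‖U.comp i‖ ^ 2 := fun i => by
    rw [← Lp.norm_fourier_eq, L2.norm_sq_eq]
    rfl
  simp only [h, Fintype.sum_sum_type, PiLp.norm_sq_eq_of_L2, State.comp]
  simp [add_assoc]

theorem State.integrable_modes (U : State) : Integrable fun ξ => ∑ i, ‖U.modes ξ i‖ ^ 2 :=
  integrable_finsetSum _ fun i _ => L2.integrable_norm_sq (𝓕 (U.comp i) : L2)

theorem State.sqrt_integral_le_norm (U : State) :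
    Real.sqrt (∫ ξ, ∑ i, ‖U.modes ξ i‖ ^ 2) ≤ U.norm := by
  rw [← U.sq_norms_eq_integral, State.norm]
  refine Real.sqrt_le_iff.2 ⟨by positivity, ?_⟩
  nlinarith [mul_nonneg (norm_nonneg U.φ) (norm_nonneg U.u),
    mul_nonneg (norm_nonneg U.φ) (norm_nonneg U.v), mul_nonneg (norm_nonneg U.u) (norm_nonneg U.v)]

theorem State.norm_le_sqrt_integral (U : State) :
    U.norm ≤ 2 * Real.sqrt (∫ ξ, ∑ i, ‖U.modes ξ i‖ ^ 2) := by
  have h : U.norm ≤ Real.sqrt (2 ^ 2 * ∫ ξ, ∑ i, ‖U.modes ξ i‖ ^ 2) := by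
    rw [← U.sq_norms_eq_integral, State.norm]
    refine Real.le_sqrt_of_sq_le ?_
    nlinarith [sq_nonneg (‖U.φ‖ - ‖U.u‖), sq_nonneg (‖U.φ‖ - ‖U.v‖), sq_nonneg (‖U.u‖ - ‖U.v‖),
      sq_nonneg ‖U.φ‖, sq_nonneg ‖U.u‖, sq_nonneg ‖U.v‖]
  rwa [Real.sqrt_mul (by norm_num), Real.sqrt_sq (by norm_num)] at h

theorem sqrt_rpow_neg_three_halves {x : ℝ} (hx : 0 ≤ x) :
    Real.sqrt (x ^ (-(3 / 2) : ℝ)) = x ^ (-(3 / 4) : ℝ) := by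
  rw [Real.sqrt_eq_rpow, ← Real.rpow_mul hx]
  norm_num

theorem State.MemL1.comp {U : State} (hU : U.MemL1) (i : Idx) :
    Integrable (U.comp i : R3 → ℂ) := by
  rcases i with i | i | i
  exacts [hU.1, hU.2.1 i, hU.2.2 i]

theorem State.MemL1.exists_bound {U : State} (hU : U.MemL1) :
    ∃ M : ℝ, 0 < M ∧ ∀ᵐ ξ : R3, ∑ i, ‖U.modes ξ i‖ ^ 2 ≤ M := by
  -- The summand `1` only secures strict positivity.
  refine ⟨(∑ i, (∫ x, ‖U.comp i x‖) ^ 2) + 1, by positivity, ?_⟩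
  filter_upwards [ae_all_iff.2 fun i => fourier_ae_eq_of_integrable _ (hU.comp i)] with ξ hξ
  have h : ∑ i, ‖U.modes ξ i‖ ^ 2 ≤ ∑ i, (∫ x, ‖U.comp i x‖) ^ 2 := by
    refine Finset.sum_le_sum fun i _ => ?_
    have h1 : U.modes ξ i = 𝓕 (U.comp i : R3 → ℂ) ξ := hξ i
    rw [h1]
    gcongr
    exact norm_fourier_le_integral _ _
  linarith

/-- Split at `k = 1`: below it `k²/(1 + k²) ≥ k²/2`, above it the ratio is at least `1/2`. -/
theorem exp_neg_rate_le {a k t : ℝ} (ha : 0 ≤ a) (ht : 0 ≤ t) :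
    Real.exp (-(a * (k ^ 2 / (1 + k ^ 2)) * t)) ≤
      Real.exp (-(a / 2 * k ^ 2 * t)) + Real.exp (-(a / 2 * t)) := by
  rcases le_total (k ^ 2) 1 with hk | hk
  · have h1 : k ^ 2 / 2 ≤ k ^ 2 / (1 + k ^ 2) := by gcongr; linarith
    have h2 : Real.exp (-(a * (k ^ 2 / (1 + k ^ 2)) * t)) ≤ Real.exp (-(a / 2 * k ^ 2 * t)) := by
      refine Real.exp_le_exp.2 (neg_le_neg ?_)
      calc a / 2 * k ^ 2 * t = a * (k ^ 2 / 2) * t := by ring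
        _ ≤ _ := by gcongr
    linarith [Real.exp_pos (-(a / 2 * t))]
  · have h1 : 1 / 2 ≤ k ^ 2 / (1 + k ^ 2) := by
      rw [div_le_div_iff₀ (by norm_num) (by positivity)]; linarith
    have h2 : Real.exp (-(a * (k ^ 2 / (1 + k ^ 2)) * t)) ≤ Real.exp (-(a / 2 * t)) := by
      refine Real.exp_le_exp.2 (neg_le_neg ?_)
      calc a / 2 * t = a * (1 / 2) * t := by ring
        _ ≤ _ := by gcongr
    linarith [Real.exp_pos (-(a / 2 * k ^ 2 * t))]

/-- From `exp x ≥ x²/2`, and `t^(-2) ≤ t^(-3/2)` for `t ≥ 1`. -/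
theorem exp_neg_mul_le {b t : ℝ} (hb : 0 < b) (ht : 1 ≤ t) :
    Real.exp (-(b * t)) ≤ 2 / b ^ 2 * t ^ (-(3 / 2) : ℝ) := by
  have h0 : 0 < t := by linarith
  have h1 : (b * t) ^ 2 / 2 ≤ Real.exp (b * t) := by
    have := Real.quadratic_le_exp_of_nonneg (x := b * t) (by positivity)
    nlinarith [mul_pos hb h0]
  calc Real.exp (-(b * t)) = (Real.exp (b * t))⁻¹ := Real.exp_neg _
    _ ≤ ((b * t) ^ 2 / 2)⁻¹ := by gcongr
    _ = 2 / b ^ 2 * t ^ (-2 : ℝ) := by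
        rw [Real.rpow_neg h0.le, Real.rpow_two]
        field_simp
    _ ≤ _ := by
        gcongr
        norm_num

theorem rpow_neg_le_mul_one_add {t : ℝ} (ht : 1 ≤ t) :
    t ^ (-(3 / 2) : ℝ) ≤ 2 ^ (3 / 2 : ℝ) * (1 + t) ^ (-(3 / 2) : ℝ) := by
  have h0 : 0 < t := by linarith
  have h1 : ((1 + t) / 2) ^ (-(3 / 2) : ℝ) = 2 ^ (3 / 2 : ℝ) * (1 + t) ^ (-(3 / 2) : ℝ) := by
    rw [Real.div_rpow (by linarith) (by norm_num), Real.rpow_neg (by norm_num : (0 : ℝ) ≤ 2)]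
    field_simp
  rw [← h1]
  exact Real.rpow_le_rpow_of_nonpos (by positivity) (by linarith) (by norm_num)

theorem integral_gaussian_R3 {b : ℝ} (hb : 0 < b) :
    ∫ ξ : R3, Real.exp (-b * ‖ξ‖ ^ 2) = (Real.pi / b) ^ (3 / 2 : ℝ) := by
  rw [GaussianFourier.integral_rexp_neg_mul_sq_norm hb]
  simp

theorem integrable_gaussian_R3 {b : ℝ} (hb : 0 < b) :
    Integrable fun ξ : R3 => Real.exp (-b * ‖ξ‖ ^ 2) := by
  refine Integrable.of_integral_ne_zero ?_
  rw [integral_gaussian_R3 hb]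
  have := Real.pi_pos
  positivity

/-- The upper decay estimate for the sum of the squared norms. -/
theorem exists_upper_bound {c : ℝ} (hc : 0 < c) {U₀ : State} (hL1 : U₀.MemL1)
    (hdiv : div U₀.v = 0) {U : ℝ → State}
    (hU : ∀ t, 0 ≤ t → ∀ i, (fun ξ => (U t).modes ξ i) =ᵐ[volume]
      fun ξ => flow (symbol c ξ) t (U₀.modes ξ) i) :
    ∃ C, 0 < C ∧ ∀ t, 1 ≤ t →
      ∫ ξ, ∑ i, ‖(U t).modes ξ i‖ ^ 2 ≤ C * (1 + t) ^ (-(3 / 2) : ℝ) := by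
  obtain ⟨K, a, hK, ha, hdecay⟩ := exists_mode_decay hc
  obtain ⟨M, hM, hbd⟩ := hL1.exists_bound
  have hpi := Real.pi_pos
  set S := ∫ ξ, ∑ i, ‖U₀.modes ξ i‖ ^ 2 with hS
  have hS0 : 0 ≤ S := integral_nonneg fun ξ => by positivity
  set b := a / 2 * (2 * Real.pi) ^ 2 with hb
  have hb0 : 0 < b := by positivity
  refine ⟨K * (M * (Real.pi / b) ^ (3 / 2 : ℝ) + 2 / (a / 2) ^ 2 * S) * 2 ^ (3 / 2 : ℝ),
    by positivity, fun t ht => ?_⟩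
  have ht0 : 0 < t := by linarith
  -- The Gaussian part uses the pointwise bound `M` coming from `L¹`; the exponentially small part
  -- keeps the data, whose integral is the finite mass `S`.
  have hpt : ∀ᵐ ξ, ∑ i, ‖(U t).modes ξ i‖ ^ 2 ≤ K * M * Real.exp (-(b * t) * ‖ξ‖ ^ 2) +
      K * Real.exp (-(a / 2 * t)) * ∑ i, ‖U₀.modes ξ i‖ ^ 2 := by
    filter_upwards [hbd, State.divOp_modes_eq_zero hdiv, ae_all_iff.2 (hU t ht0.le)]
      with ξ h1 h2 h3
    simp only [h3]
    refine (hdecay ξ _ h2 t ht0.le).trans ?_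
    have h4 := exp_neg_rate_le (k := 2 * Real.pi * ‖ξ‖) ha.le ht0.le
    have h5 : -(a / 2 * (2 * Real.pi * ‖ξ‖) ^ 2 * t) = -(b * t) * ‖ξ‖ ^ 2 := by rw [hb]; ring
    rw [h5] at h4
    have h6 : 0 ≤ ∑ i, ‖U₀.modes ξ i‖ ^ 2 := by positivity
    calc _ ≤ K * (Real.exp (-(b * t) * ‖ξ‖ ^ 2) + Real.exp (-(a / 2 * t))) *
          ∑ i, ‖U₀.modes ξ i‖ ^ 2 := by gcongr
      _ = K * Real.exp (-(b * t) * ‖ξ‖ ^ 2) * ∑ i, ‖U₀.modes ξ i‖ ^ 2 +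
          K * Real.exp (-(a / 2 * t)) * ∑ i, ‖U₀.modes ξ i‖ ^ 2 := by ring
      _ ≤ K * Real.exp (-(b * t) * ‖ξ‖ ^ 2) * M +
          K * Real.exp (-(a / 2 * t)) * ∑ i, ‖U₀.modes ξ i‖ ^ 2 := by gcongr
      _ = _ := by ring
  have hi1 := (integrable_gaussian_R3 (mul_pos hb0 ht0)).const_mul (K * M)
  have hi2 := U₀.integrable_modes.const_mul (K * Real.exp (-(a / 2 * t)))
  have hgauss : (Real.pi / (b * t)) ^ (3 / 2 : ℝ) =
      (Real.pi / b) ^ (3 / 2 : ℝ) * t ^ (-(3 / 2) : ℝ) := by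
    rw [← div_div, Real.div_rpow (by positivity) ht0.le, Real.rpow_neg ht0.le, div_eq_mul_inv]
  calc ∫ ξ, ∑ i, ‖(U t).modes ξ i‖ ^ 2
      ≤ ∫ ξ, (K * M * Real.exp (-(b * t) * ‖ξ‖ ^ 2) +
          K * Real.exp (-(a / 2 * t)) * ∑ i, ‖U₀.modes ξ i‖ ^ 2) :=
        integral_mono_ae (U t).integrable_modes (hi1.add hi2) hpt
    _ = K * M * ((Real.pi / b) ^ (3 / 2 : ℝ) * t ^ (-(3 / 2) : ℝ)) +
          K * Real.exp (-(a / 2 * t)) * S := by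
        rw [integral_add hi1 hi2, integral_const_mul, integral_const_mul,
          integral_gaussian_R3 (mul_pos hb0 ht0), hgauss]
    _ ≤ K * M * ((Real.pi / b) ^ (3 / 2 : ℝ) * t ^ (-(3 / 2) : ℝ)) +
          K * (2 / (a / 2) ^ 2 * t ^ (-(3 / 2) : ℝ)) * S := by
        gcongr
        exact exp_neg_mul_le (by positivity) ht
    _ = K * (M * (Real.pi / b) ^ (3 / 2 : ℝ) + 2 / (a / 2) ^ 2 * S) * t ^ (-(3 / 2) : ℝ) := by
        ring
    _ ≤ K * (M * (Real.pi / b) ^ (3 / 2 : ℝ) + 2 / (a / 2) ^ 2 * S) *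
          (2 ^ (3 / 2 : ℝ) * (1 + t) ^ (-(3 / 2) : ℝ)) := by
        gcongr
        exact rpow_neg_le_mul_one_add ht
    _ = _ := by ring

/-! ### Lower decay bound -/

/-- The larger root. The threshold `3/16` makes the square root of the discriminant at least `1/2`,
so `1 + r ≥ 1/2`, and `r(1 + r) = -k²` then forces `r ≥ -2k²`. -/
theorem exists_slow_eigenvalue {k : ℝ} (hk : k ^ 2 ≤ 3 / 16) :
    ∃ r : ℝ, r ^ 2 + r + k ^ 2 = 0 ∧ -(2 * k ^ 2) ≤ r ∧ r ≤ 0 ∧ 1 / 2 ≤ 1 + r := by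
  have h0 : 0 ≤ 1 - 4 * k ^ 2 := by linarith
  have h1 := Real.sq_sqrt h0
  have h2 : 1 / 2 ≤ Real.sqrt (1 - 4 * k ^ 2) := Real.le_sqrt_of_sq_le (by linarith)
  have h3 : Real.sqrt (1 - 4 * k ^ 2) ≤ 1 := Real.sqrt_le_one.2 (by nlinarith [sq_nonneg k])
  refine ⟨(-1 + Real.sqrt (1 - 4 * k ^ 2)) / 2, by nlinarith, by nlinarith, by linarith,
    by linarith⟩

/-- A lower bound for a single mode of small frequency. -/
theorem mode_lower_bound (c : ℝ) {ξ : R3} {y : Idx → ℂ} (hy : divOp ξ (vPart y) = 0)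
    {b M : ℝ} (hb : 0 < b) (hφ : b ≤ ‖y iφ‖) (hM : ∑ i, ‖y i‖ ^ 2 ≤ M ^ 2) (hM0 : 0 < M)
    (hk : (2 * Real.pi * ‖ξ‖) ^ 2 ≤ 3 / 16) (hkM : 2 * Real.pi * ‖ξ‖ * M ≤ b / 4) (t : ℝ)
    (ht : 0 ≤ t) :
    b ^ 2 / 32 * Real.exp (-(4 * (2 * Real.pi * ‖ξ‖) ^ 2 * t)) ≤
      ∑ i, ‖flow (symbol c ξ) t y i‖ ^ 2 := by
  set k := 2 * Real.pi * ‖ξ‖ with hkdef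
  have hk0 : 0 ≤ k := by positivity
  have hk1 : k ≤ 1 := by nlinarith
  obtain ⟨r, hr, hr2, hr0, hr1⟩ := exists_slow_eigenvalue hk
  have S := modeSystem c ξ y hy
  have hs := S.slow_mode hr t
  simp only [flow_zero] at hs
  have hu0 : ‖uPart y‖ ≤ M := by
    refine abs_le_of_sq_le_sq' ?_ hM0.le |>.2
    rw [sum_norm_sq_eq] at hM
    nlinarith [sq_nonneg ‖y iφ‖, sq_nonneg ‖vPart y‖]
  -- The `φ` term contributes at least `b/2` and the divergence at most `kM ≤ b/4`.
  have h0 : b / 4 ≤ ‖(1 + r) • y iφ - divOp ξ (uPart y)‖ := by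
    have h1 := norm_sub_norm_le ((1 + r) • y iφ) (divOp ξ (uPart y))
    have h2 := S.norm_div_le hk0 (uPart y)
    rw [norm_smul, Real.norm_of_nonneg (by linarith)] at h1
    have h3 : 1 / 2 * b ≤ (1 + r) * ‖y iφ‖ := by gcongr
    have h4 : k * ‖uPart y‖ ≤ k * M := by gcongr
    linarith
  set z := flow (symbol c ξ) t y with hz
  have h1 : ‖(1 + r) • z iφ - divOp ξ (uPart z)‖ ≤ ‖z iφ‖ + ‖uPart z‖ := by
    refine (norm_sub_le _ _).trans (add_le_add ?_ ?_)
    · rw [norm_smul, Real.norm_of_nonneg (by linarith)]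
      exact mul_le_of_le_one_left (norm_nonneg _) (by linarith)
    · exact (S.norm_div_le hk0 _).trans (mul_le_of_le_one_left (norm_nonneg _) hk1)
  have h2 : Real.exp (-(2 * k ^ 2 * t)) * (b / 4) ≤ ‖z iφ‖ + ‖uPart z‖ := by
    refine le_trans ?_ h1
    rw [hs, norm_smul, Real.norm_of_nonneg (Real.exp_pos _).le]
    gcongr
    nlinarith
  have h3 : Real.exp (-(4 * k ^ 2 * t)) = Real.exp (-(2 * k ^ 2 * t)) ^ 2 := by
    rw [← Real.exp_nat_mul]
    congr 1
    push_cast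
    ring
  have h4 : (Real.exp (-(2 * k ^ 2 * t)) * (b / 4)) ^ 2 ≤ (‖z iφ‖ + ‖uPart z‖) ^ 2 := by
    gcongr
  rw [sum_norm_sq_eq, h3]
  -- The `32` is `4²` from `b/4`, times `2` from `(x + y)² ≤ 2(x² + y²)`.
  nlinarith [sq_nonneg (‖z iφ‖ - ‖uPart z‖), sq_nonneg ‖vPart z‖]

/-- The lower decay estimate for the sum of the squared norms. -/
theorem exists_lower_bound (c : ℝ) {U₀ : State} (hL1 : U₀.MemL1) (hdiv : div U₀.v = 0)
    {c₀ r₀ : ℝ} (hc₀ : 0 < c₀) (hr₀ : 0 < r₀)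
    (hφ : ∀ ξ : R3, ‖ξ‖ < r₀ → c₀ ≤ ‖ft U₀.φ ξ‖) {U : ℝ → State}
    (hU : ∀ t, 0 ≤ t → ∀ i, (fun ξ => (U t).modes ξ i) =ᵐ[volume]
      fun ξ => flow (symbol c ξ) t (U₀.modes ξ) i) :
    ∃ C t₀, 0 < C ∧ 1 ≤ t₀ ∧ ∀ t, t₀ ≤ t →
      C * (1 + t) ^ (-(3 / 2) : ℝ) ≤ ∫ ξ, ∑ i, ‖(U t).modes ξ i‖ ^ 2 := by
  obtain ⟨M', hM', hbd'⟩ := hL1.exists_bound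
  set M := Real.sqrt M' with hMdef
  have hM : 0 < M := Real.sqrt_pos.2 hM'
  have hMsq : M ^ 2 = M' := Real.sq_sqrt hM'.le
  have hpi := Real.pi_pos
  set N : ℝ := (2 * Real.pi) ^ (-(3 / 2) : ℝ) with hN
  have hN0 : 0 < N := by positivity
  set b := c₀ / N with hb
  have hb0 : 0 < b := by positivity
  have hφb : ∀ᵐ ξ : R3, 2 * Real.pi * ‖ξ‖ < r₀ → b ≤ ‖U₀.modes ξ iφ‖ := by
    filter_upwards [fourier_ae_eq_of_integrable _ hL1.1] with ξ hξ hr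
    have h1 : U₀.modes ξ iφ = 𝓕 (U₀.φ : R3 → ℂ) ξ := hξ
    have h2 := hφ ((2 * Real.pi) • ξ) (by
      rwa [norm_smul, Real.norm_of_nonneg (by positivity)])
    rw [ft_eq, smul_smul, inv_mul_cancel₀ (by positivity), one_smul, norm_mul, Complex.norm_real,
      Real.norm_of_nonneg hN0.le] at h2
    rw [h1, hb, div_le_iff₀ hN0, mul_comm]
    exact h2
  -- The three bounds serve, in order, the slow root (`1/16 ≤ 3/16`), the lower bound on `φ̂₀`, and
  -- the smallness of `div u₀`.
  set k₀ := min (min (1 / 4) r₀) (b / (4 * M)) with hk₀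
  have hk₀0 : 0 < k₀ := lt_min (lt_min (by norm_num) hr₀) (by positivity)
  set w := (volume : Measure R3).real (Metric.ball 0 1) with hw
  have hw0 : 0 < w := ENNReal.toReal_pos (Metric.measure_ball_pos _ _ one_pos).ne'
    measure_ball_lt_top.ne
  set β := b ^ 2 / 32 * Real.exp (-4) with hβ
  refine ⟨β * ((2 * Real.pi)⁻¹ ^ 3 * w), max 1 ((k₀ ^ 2)⁻¹), by positivity, le_max_left _ _,
    fun t ht => ?_⟩
  have ht1 : 1 ≤ t := (le_max_left _ _).trans ht
  have ht0 : 0 < t := by linarith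
  have htk : (k₀ ^ 2)⁻¹ ≤ t := (le_max_right _ _).trans ht
  have hst : 0 < Real.sqrt t := Real.sqrt_pos.2 ht0
  have hst2 : Real.sqrt t ^ 2 = t := Real.sq_sqrt ht0.le
  -- On this ball `k²t ≤ 1`, so the exponential is at least `exp(-4)`; the condition `t ≥ k₀⁻²`
  -- keeps the ball inside `k < k₀`.
  set ρ := (2 * Real.pi * Real.sqrt t)⁻¹ with hρ
  have hρ0 : 0 < ρ := by positivity
  have hρk : 2 * Real.pi * ρ = (Real.sqrt t)⁻¹ := by rw [hρ]; field_simp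
  have hinv : (Real.sqrt t)⁻¹ ≤ k₀ := by
    rw [inv_le_comm₀ hst hk₀0]
    refine Real.le_sqrt_of_sq_le ?_
    rwa [inv_pow]
  have hpt : ∀ᵐ ξ, (Metric.ball (0 : R3) ρ).indicator (fun _ => β) ξ ≤
      ∑ i, ‖(U t).modes ξ i‖ ^ 2 := by
    filter_upwards [hbd', State.divOp_modes_eq_zero hdiv, ae_all_iff.2 (hU t ht0.le), hφb]
      with ξ h1 h2 h3 h4
    by_cases hξ : ξ ∈ Metric.ball (0 : R3) ρ
    · rw [indicator_of_mem hξ]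
      have hξρ : ‖ξ‖ < ρ := by simpa using hξ
      have hkt : 2 * Real.pi * ‖ξ‖ < (Real.sqrt t)⁻¹ := by
        rw [← hρk]; gcongr
      have hkk : 2 * Real.pi * ‖ξ‖ < k₀ := hkt.trans_le hinv
      have hk4 : 2 * Real.pi * ‖ξ‖ < 1 / 4 :=
        hkk.trans_le ((min_le_left _ _).trans (min_le_left _ _))
      have hkr : 2 * Real.pi * ‖ξ‖ < r₀ :=
        hkk.trans_le ((min_le_left _ _).trans (min_le_right _ _))
      have hkM : 2 * Real.pi * ‖ξ‖ * M ≤ b / 4 := by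
        have h5 : 2 * Real.pi * ‖ξ‖ ≤ b / (4 * M) := (hkk.trans_le (min_le_right _ _)).le
        calc 2 * Real.pi * ‖ξ‖ * M ≤ b / (4 * M) * M := by gcongr
          _ = b / 4 := by field_simp
      have hk0 : 0 ≤ 2 * Real.pi * ‖ξ‖ := by positivity
      have h5 := mode_lower_bound c h2 hb0 (h4 hkr) (by rw [hMsq]; exact h1) hM (by nlinarith) hkM
        t ht0.le
      simp only [h3]
      refine le_trans ?_ h5
      rw [hβ]
      gcongr
      have h6 : (2 * Real.pi * ‖ξ‖) ^ 2 * t ≤ 1 := by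
        calc (2 * Real.pi * ‖ξ‖) ^ 2 * t ≤ (Real.sqrt t)⁻¹ ^ 2 * t := by gcongr
          _ = 1 := by rw [inv_pow, hst2, inv_mul_cancel₀ ht0.ne']
      linarith
    · rw [indicator_of_notMem hξ]
      positivity
  have hint : Integrable ((Metric.ball (0 : R3) ρ).indicator fun _ => β) :=
    (integrable_indicator_iff measurableSet_ball).2 (integrableOn_const measure_ball_lt_top.ne)
  have hvol : (volume : Measure R3).real (Metric.ball 0 ρ) = ρ ^ 3 * w := by
    rw [measureReal_def, Measure.addHaar_ball_of_pos _ _ hρ0, ENNReal.toReal_mul,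
      ENNReal.toReal_ofReal (by positivity)]
    simp [hw, measureReal_def]
  have hρ3 : ρ ^ 3 = (2 * Real.pi)⁻¹ ^ 3 * t ^ (-(3 / 2) : ℝ) := by
    rw [hρ, mul_inv, mul_pow]
    congr 1
    rw [Real.sqrt_eq_rpow, ← Real.rpow_neg ht0.le, ← Real.rpow_natCast, ← Real.rpow_mul ht0.le]
    norm_num
  have hmono : (1 + t) ^ (-(3 / 2) : ℝ) ≤ t ^ (-(3 / 2) : ℝ) :=
    Real.rpow_le_rpow_of_nonpos ht0 (by linarith) (by norm_num)
  calc β * ((2 * Real.pi)⁻¹ ^ 3 * w) * (1 + t) ^ (-(3 / 2) : ℝ)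
      ≤ β * ((2 * Real.pi)⁻¹ ^ 3 * w) * t ^ (-(3 / 2) : ℝ) := by gcongr
    _ = ∫ ξ, (Metric.ball (0 : R3) ρ).indicator (fun _ => β) ξ := by
        rw [integral_indicator_const _ measurableSet_ball, hvol, hρ3, smul_eq_mul]
        ring
    _ ≤ _ := integral_mono_ae hint (U t).integrable_modes hpt

end ENS


/-! ### Well-posedness and two-sided decay -/

theorem proposition4p3 (c : ℝ) (hc : 0 < c) (s : ℕ) (hs : 3 ≤ s) (U₀ : ENS.State)
    (hH : U₀.MemH s) (hL1 : U₀.MemL1) (hdiv : ENS.div U₀.v = 0)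
    (c₀ r₀ : ℝ) (hc₀ : 0 < c₀) (hr₀ : 0 < r₀)
    (hφ : ∀ ξ : ENS.R3, ‖ξ‖ < r₀ → c₀ ≤ ‖ENS.ft U₀.φ ξ‖)
    (hu : ∀ ξ : ENS.R3, ξ ≠ 0 → ∀ j : Fin 3,
      ENS.ft (U₀.u j) ξ
        - ∑ k : Fin 3, ((ξ j * ξ k / ‖ξ‖ ^ 2 : ℝ) : ℂ) * ENS.ft (U₀.u k) ξ = 0) :
    ∃ U : ℝ → ENS.State, ENS.IsGlobalSolution c s U₀ U ∧
      (∀ V : ℝ → ENS.State, ENS.IsGlobalSolution c s U₀ V → ∀ t : ℝ, 0 ≤ t → V t = U t) ∧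
      ∃ cstar C t₀ : ℝ, 0 < cstar ∧ 0 < C ∧ 0 < t₀ ∧ ∀ t : ℝ, t₀ ≤ t →
        cstar * (1 + t) ^ (-(3 / 4) : ℝ) ≤ (U t).norm ∧
        (U t).norm ≤ C * (1 + t) ^ (-(3 / 4) : ℝ) := by
  obtain ⟨U, hU, hUflow⟩ := ENS.exists_solution hc (by lia : 2 ≤ s) hH hdiv
  obtain ⟨C, hC, hupper⟩ := ENS.exists_upper_bound hc hL1 hdiv hUflow
  obtain ⟨C', t₀, hC', ht₀, hlower⟩ := ENS.exists_lower_bound c hL1 hdiv hc₀ hr₀ hφ hUflow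
  -- The estimates concern the sum of squared norms, hence the square roots; the `2` compares the
  -- sum of three norms with their Euclidean sum.
  refine ⟨U, hU, fun V hV t ht => hU.unique (by lia) hV ht, Real.sqrt C', 2 * Real.sqrt C, t₀,
    Real.sqrt_pos.2 hC', by positivity, by linarith, fun t ht => ⟨?_, ?_⟩⟩
  · refine le_trans ?_ (U t).sqrt_integral_le_norm
    rw [← ENS.sqrt_rpow_neg_three_halves (by linarith), ← Real.sqrt_mul hC'.le]
    exact Real.sqrt_le_sqrt (hlower t ht)
  · refine (U t).norm_le_sqrt_integral.trans ?_
    rw [← ENS.sqrt_rpow_neg_three_halves (by linarith), mul_assoc, ← Real.sqrt_mul hC.le]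
    gcongr
    exact hupper t (ht₀.trans ht)
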